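/- Let $A$ and $B$ be associative rings with identity, let ${}_AM_B$ be an $A$-$B$-bimodule, and let $\Lambda=\begin{bmatrix} A & M\\ 0 & B\end{bmatrix}$ be the corresponding triangular matrix ring. All modules are unitary left modules, not necessarily finitely generated. A left $\Lambda$-module is identified with a triple $(X,Y,g)$, where $X$ is an $A$-module, $Y$ is a $B$-module and $g\colon M\otimes_B Y\to X$ is an $A$-linear map; the action on columns is $\begin{bmatrix} a & m\\ 0 & b\end{bmatrix}\begin{bmatrix} x\\ y\end{bmatrix}=\begin{bmatrix} ax+g(m\otimes y)\\ by\end{bmatrix}$. For a ring $R$, a complete $R$-projective resolution is an exact sequence $P^\bullet=(\cdots\to P^{-1}\xrightarrow{d^{-1}}P^0\xrightarrow{d^0}P^1\to\cdots)$ of projective $R$-modules, indexed by $\mathbb Z$, such that the complex $\operatorname{Hom}_R(P^\bullet,Q)$ is exact for every projective $R$-module $Q$. An $R$-module is Gorenstein projective if it is isomorphic to $\operatorname{Im}(d^0)$ for some complete $R$-projective resolution $(P^\bullet,d^\bullet)$; write $\operatorname{GProj}R$ for the class of these modules. Write $\operatorname{Add}M$ for the class of $A$-modules isomorphic to direct summands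 of direct sums of copies of ${}_AM$. Assume that (i) for every exact sequence $Q^\bullet$ of projective $B$-modules, indexed by $\mathbb Z$, the complex $M\otimes_BQ^\bullet$ is exact; and (ii) for every complete $A$-projective resolution $P^\bullet$ and every $N\in\operatorname{Add}M$, the complex $\operatorname{Hom}_A(P^\bullet,N)$ is exact. Then, for every $\Lambda$-module $(X,Y,g)$, one has $(X,Y,g)\in\operatorname{GProj}\Lambda$ if and only if $\operatorname{Coker}g\in\operatorname{GProj}A$, $Y\in\operatorname{GProj}B$ and $g$ is a monomorphism. -/

import Mathlib

universe u

set_option linter.unusedSectionVars false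

open scoped TensorProduct

/-! ### Complete projective resolutions and Gorenstein projective modules -/

/-- An exact sequence `⋯ → P (-1) → P 0 → P 1 → ⋯` of projective left `R`-modules
(not necessarily finitely generated), indexed by all integers. -/
structure ExactProjectiveComplex (R : Type u) [Ring R] where
  P : ℤ → Type u
  [addCommGroup : ∀ i, AddCommGroup (P i)]
  [module : ∀ i, Module R (P i)]
  projective : ∀ i, Module.Projective R (P i)
  d : ∀ i, P i →ₗ[R] P (i + 1)
  exact : ∀ i, Function.Exact (d i) (d (i + 1))

attribute [instance] ExactProjectiveComplex.addCommGroup ExactProjectiveComplex.module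

namespace ExactProjectiveComplex

variable {R : Type u} [Ring R]

/-- The complex of abelian groups `Hom_R(P•, N)`, with terms `Hom_R(P i, N)` and differentials
`h ↦ h ∘ d i : Hom_R(P (i + 1), N) → Hom_R(P i, N)`, is exact. -/
def HomExact (C : ExactProjectiveComplex R) (N : Type u) [AddCommGroup N] [Module R N] : Prop :=
  ∀ i, Function.Exact
    (fun h : C.P (i + 1 + 1) →ₗ[R] N => h ∘ₗ C.d (i + 1))
    (fun h : C.P (i + 1) →ₗ[R] N => h ∘ₗ C.d i)

/-- `P•` is a complete projective resolution: moreover `Hom_R(P•, Q)` is exact for every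
projective `R`-module `Q`. -/
def IsComplete (C : ExactProjectiveComplex R) : Prop :=
  ∀ (Q : Type u) [AddCommGroup Q] [Module R Q], Module.Projective R Q → C.HomExact Q

end ExactProjectiveComplex

/-- `G` is Gorenstein projective: it is (isomorphic to) the image of `d 0` for some complete
projective resolution. -/
def GorensteinProjective (R : Type u) [Ring R] (G : Type u) [AddCommGroup G] [Module R G] : Prop :=
  ∃ C : ExactProjectiveComplex R, C.IsComplete ∧ Nonempty (G ≃ₗ[R] LinearMap.range (C.d 0))

/-- `N` belongs to `Add M`: it is isomorphic to a direct summand of a direct sum of copies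
of `M`. -/
def MemAdd (R : Type u) [Ring R] (M : Type u) [AddCommGroup M] [Module R M]
    (N : Type u) [AddCommGroup N] [Module R N] : Prop :=
  ∃ (ι : Type u) (s : N →ₗ[R] (ι →₀ M)) (r : (ι →₀ M) →ₗ[R] N), r ∘ₗ s = LinearMap.id

/-! ### The tensor product over a noncommutative ring -/

section Bimodule

variable (A B M : Type u) [Ring A] [Ring B] [AddCommGroup M] [Module A M] [Module Bᵐᵒᵖ M]
  [SMulCommClass A Bᵐᵒᵖ M]

/-- The relations `(m b) ⊗ y = m ⊗ (b y)` in `M ⊗[ℤ] Y`. The set of generators is stable under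
the left action of `A` (the two actions on `M` commute), so its `A`-span is the additive subgroup
that it generates. -/
def balancedRelations (Y : Type u) [AddCommGroup Y] [Module B Y] : Submodule A (M ⊗[ℤ] Y) :=
  Submodule.span A {t | ∃ (m : M) (b : B) (y : Y),
    t = (MulOpposite.op b • m) ⊗ₜ[ℤ] y - m ⊗ₜ[ℤ] (b • y)}

/-- The left `A`-module `M ⊗_B Y`, for an `A`-`B`-bimodule `M` (the right action of `B` is an
action of `Bᵐᵒᵖ`) and a left `B`-module `Y`. -/
abbrev BimoduleTensor (Y : Type u) [AddCommGroup Y] [Module B Y] : Type u :=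
  (M ⊗[ℤ] Y) ⧸ balancedRelations A B M Y

variable {M} in
/-- The element `m ⊗ y` of `M ⊗_B Y`. -/
def BimoduleTensor.tmul {Y : Type u} [AddCommGroup Y] [Module B Y] (m : M) (y : Y) :
    BimoduleTensor A B M Y :=
  (balancedRelations A B M Y).mkQ (m ⊗ₜ[ℤ] y)

/-- The `A`-linear map `M ⊗_B f : M ⊗_B Y → M ⊗_B Z`, `m ⊗ y ↦ m ⊗ f y`. -/
def BimoduleTensor.map {Y Z : Type u} [AddCommGroup Y] [Module B Y] [AddCommGroup Z] [Module B Z]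
    (f : Y →ₗ[B] Z) : BimoduleTensor A B M Y →ₗ[A] BimoduleTensor A B M Z :=
  Submodule.mapQ (balancedRelations A B M Y) (balancedRelations A B M Z)
    (TensorProduct.AlgebraTensorModule.map (LinearMap.id : M →ₗ[A] M) f.toAddMonoidHom.toIntLinearMap)
    (by
      rw [balancedRelations, Submodule.span_le]
      rintro _ ⟨m, b, y, rfl⟩
      refine Submodule.subset_span ⟨m, b, f y, ?_⟩
      simp)

variable {A B M} in
theorem BimoduleTensor.map_tmul {Y Z : Type u} [AddCommGroup Y] [Module B Y] [AddCommGroup Z]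
    [Module B Z] (f : Y →ₗ[B] Z) (m : M) (y : Y) :
    BimoduleTensor.map A B M f (BimoduleTensor.tmul A B m y) = BimoduleTensor.tmul A B m (f y) :=
  rfl

variable {A B M} in
theorem BimoduleTensor.tmul_smul {Y : Type u} [AddCommGroup Y] [Module B Y]
    (m : M) (b : B) (y : Y) :
    BimoduleTensor.tmul A B m (b • y) = BimoduleTensor.tmul A B (MulOpposite.op b • m) y :=
  Eq.symm ((Submodule.Quotient.eq _).2 (Submodule.subset_span ⟨m, b, y, rfl⟩))

variable {A B M} in
theorem BimoduleTensor.smul_tmul {Y : Type u} [AddCommGroup Y] [Module B Y]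
    (a : A) (m : M) (y : Y) :
    a • BimoduleTensor.tmul A B m y = BimoduleTensor.tmul A B (a • m) y :=
  rfl

variable {A B M} in
theorem BimoduleTensor.add_tmul {Y : Type u} [AddCommGroup Y] [Module B Y]
    (m m' : M) (y : Y) :
    BimoduleTensor.tmul A B (m + m') y = BimoduleTensor.tmul A B m y + BimoduleTensor.tmul A B m' y := by
  simp only [BimoduleTensor.tmul, TensorProduct.add_tmul, _root_.map_add]

variable {A B M} in
theorem BimoduleTensor.tmul_add {Y : Type u} [AddCommGroup Y] [Module B Y]
    (m : M) (y y' : Y) :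
    BimoduleTensor.tmul A B m (y + y') = BimoduleTensor.tmul A B m y + BimoduleTensor.tmul A B m y' := by
  simp only [BimoduleTensor.tmul, TensorProduct.tmul_add, _root_.map_add]

/-! ### The triangular matrix ring -/

/-- The triangular matrix `[[a, m], [0, b]]` with `a : A`, `m : M`, `b : B`. -/
@[ext]
structure TriangularMatrixRing where
  a : A
  m : M
  b : B

namespace TriangularMatrixRing

variable {A B M}

/-- A triangular matrix as the triple of its entries. -/
def equivProd : TriangularMatrixRing A B M ≃ A × M × B where
  toFun t := (t.a, t.m, t.b)
  invFun t := ⟨t.1, t.2.1, t.2.2⟩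

/-- Addition of triangular matrices is entrywise. -/
instance : AddCommGroup (TriangularMatrixRing A B M) := equivProd.addCommGroup

instance : One (TriangularMatrixRing A B M) := ⟨⟨1, 0, 1⟩⟩

/-- Matrix multiplication; `MulOpposite.op b • m` is `m b`. -/
instance : Mul (TriangularMatrixRing A B M) :=
  ⟨fun s t => ⟨s.a * t.a, s.a • t.m + MulOpposite.op t.b • s.m, s.b * t.b⟩⟩

@[simp] theorem zero_a : (0 : TriangularMatrixRing A B M).a = 0 := rfl
@[simp] theorem zero_m : (0 : TriangularMatrixRing A B M).m = 0 := rfl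
@[simp] theorem zero_b : (0 : TriangularMatrixRing A B M).b = 0 := rfl
@[simp] theorem one_a : (1 : TriangularMatrixRing A B M).a = 1 := rfl
@[simp] theorem one_m : (1 : TriangularMatrixRing A B M).m = 0 := rfl
@[simp] theorem one_b : (1 : TriangularMatrixRing A B M).b = 1 := rfl
@[simp] theorem add_a (s t : TriangularMatrixRing A B M) : (s + t).a = s.a + t.a := rfl
@[simp] theorem add_m (s t : TriangularMatrixRing A B M) : (s + t).m = s.m + t.m := rfl
@[simp] theorem add_b (s t : TriangularMatrixRing A B M) : (s + t).b = s.b + t.b := rfl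
@[simp] theorem mul_a (s t : TriangularMatrixRing A B M) : (s * t).a = s.a * t.a := rfl
@[simp] theorem mul_m (s t : TriangularMatrixRing A B M) :
    (s * t).m = s.a • t.m + MulOpposite.op t.b • s.m := rfl
@[simp] theorem mul_b (s t : TriangularMatrixRing A B M) : (s * t).b = s.b * t.b := rfl

instance : Ring (TriangularMatrixRing A B M) :=
  { (inferInstance : AddCommGroup (TriangularMatrixRing A B M)),
    (inferInstance : One (TriangularMatrixRing A B M)),
    (inferInstance : Mul (TriangularMatrixRing A B M)) with
    left_distrib := fun x y z => by
      ext <;> simp [mul_add, add_smul, add_add_add_comm]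
    right_distrib := fun x y z => by
      ext <;> simp [add_mul, add_smul, add_add_add_comm]
    zero_mul := fun x => by ext <;> simp
    mul_zero := fun x => by ext <;> simp
    mul_assoc := fun x y z => by
      ext <;> simp [mul_assoc, mul_smul, smul_comm, add_assoc]
    one_mul := fun x => by ext <;> simp
    mul_one := fun x => by ext <;> simp }

end TriangularMatrixRing

/-! ### The module given by a triple -/

variable {A B M}
variable {X Y : Type u} [AddCommGroup X] [Module A X] [AddCommGroup Y] [Module B Y]

/-- The left module `(X, Y, g)` over the triangular matrix ring, for an `A`-linear map
`g : M ⊗_B Y → X`: the group of columns `(x, y)ᵗ`, on which `[[a, m], [0, b]]` acts by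
`(x, y)ᵗ ↦ (a x + g (m ⊗ y), b y)ᵗ`. -/
def TripleModule (_g : BimoduleTensor A B M Y →ₗ[A] X) : Type u := X × Y

namespace TripleModule

variable (g : BimoduleTensor A B M Y →ₗ[A] X)

instance : AddCommGroup (TripleModule g) := inferInstanceAs (AddCommGroup (X × Y))

instance : Module (TriangularMatrixRing A B M) (TripleModule g) where
  smul t v := (t.a • v.1 + g (BimoduleTensor.tmul A B t.m v.2), t.b • v.2)
  one_smul v := by
    refine Prod.ext ?_ ?_
    · change (1 : A) • v.1 + g (BimoduleTensor.tmul A B (0 : M) v.2) = v.1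
      simp [BimoduleTensor.tmul]
    · exact one_smul B v.2
  mul_smul s t v := by
    refine Prod.ext ?_ ?_
    · change (s.a * t.a) • v.1
          + g (BimoduleTensor.tmul A B (s.a • t.m + MulOpposite.op t.b • s.m) v.2)
        = s.a • (t.a • v.1 + g (BimoduleTensor.tmul A B t.m v.2))
          + g (BimoduleTensor.tmul A B s.m (t.b • v.2))
      rw [BimoduleTensor.tmul_smul, BimoduleTensor.add_tmul, ← BimoduleTensor.smul_tmul,
        map_add, map_smul, smul_add, mul_smul, add_assoc]
    · exact mul_smul s.b t.b v.2
  smul_zero t := by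
    refine Prod.ext ?_ ?_
    · change t.a • (0 : X) + g (BimoduleTensor.tmul A B t.m (0 : Y)) = 0
      simp [BimoduleTensor.tmul]
    · exact smul_zero t.b
  smul_add t v w := by
    refine Prod.ext ?_ ?_
    · change t.a • (v.1 + w.1) + g (BimoduleTensor.tmul A B t.m (v.2 + w.2))
        = (t.a • v.1 + g (BimoduleTensor.tmul A B t.m v.2))
          + (t.a • w.1 + g (BimoduleTensor.tmul A B t.m w.2))
      rw [BimoduleTensor.tmul_add, map_add, smul_add, add_add_add_comm]
    · exact smul_add t.b v.2 w.2
  add_smul s t v := by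
    refine Prod.ext ?_ ?_
    · change (s.a + t.a) • v.1 + g (BimoduleTensor.tmul A B (s.m + t.m) v.2)
        = (s.a • v.1 + g (BimoduleTensor.tmul A B s.m v.2))
          + (t.a • v.1 + g (BimoduleTensor.tmul A B t.m v.2))
      rw [BimoduleTensor.add_tmul, map_add, add_smul, add_add_add_comm]
    · exact add_smul s.b t.b v.2
  zero_smul v := by
    refine Prod.ext ?_ ?_
    · change (0 : A) • v.1 + g (BimoduleTensor.tmul A B (0 : M) v.2) = 0
      simp [BimoduleTensor.tmul]
    · exact zero_smul B v.2

end TripleModule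

end Bimodule

/-! ### Factorisations and short exact sequences -/

section Linear

variable {R : Type u} [Ring R]

/-! The argument is coinductive. Call a class of modules stable if every member is the kernel of a
surjection from a projective onto a member, and also a quotient of a projective by a member.
Splicing yields a `ℤ`-indexed exact complex of projectives with all images in the class. If moreover
`Ext¹` from the class into projectives vanishes, the complex is complete and all members are
Gorenstein projective (`GorensteinProjective.of_class`); the Gorenstein projectives themselves form
such a class. Hypothesis (i) gives `Tor₁(M, Y) = 0` on every stable class of `B`-modules, without
any `Ext` condition. Hypothesis (ii) gives `Ext¹(G, M ⊗_B Q) = 0` for `G` in `GProj A` and `Q`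
projective, since `M ⊗_B Q` lies in `Add M`.

A projective triple has an injective structure map with projective cokernel, and a projective lower
component; conversely every `(P ⊕ M ⊗_B Q, Q, inr)` is projective.

For a Gorenstein projective `(X, Y, g)`, the lower components form a stable class, so `Tor₁`
vanishes on them and an embedding into a projective triple forces `g` to be injective. By the snake
lemma the cokernels then form a stable class too, and their `Ext¹` into a projective `N` is tested
against the triple `(N, 0, 0)`. Only afterwards is `Ext¹(Y, Q) = 0` obtained, by testing against `(M
⊗_B Q, Q, id)`: (ii) applies because the cokernels are already Gorenstein projective.

Conversely, the triples satisfying the three conditions form a stable class by horseshoe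
constructions, and `Ext¹` into a projective triple is killed one component at a time. -/

theorem LinearMap.exists_comp_eq_of_surjective {U V W : Type*} [AddCommGroup U] [Module R U]
    [AddCommGroup V] [Module R V] [AddCommGroup W] [Module R W]
    (q : U →ₗ[R] V) (hq : Function.Surjective q) (f : U →ₗ[R] W)
    (h : ∀ x, q x = 0 → f x = 0) : ∃ k : V →ₗ[R] W, k ∘ₗ q = f := by
  refine ⟨(LinearMap.ker q).liftQ f (fun x hx => h x hx) ∘ₗ
    (q.quotKerEquivOfSurjective hq).symm.toLinearMap, ?_⟩
  ext x
  have : (q.quotKerEquivOfSurjective hq).symm (q x) = (LinearMap.ker q).mkQ x := by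
    rw [LinearEquiv.symm_apply_eq]; rfl
  rw [LinearMap.comp_apply, LinearMap.comp_apply, LinearEquiv.coe_coe, this]
  rfl

theorem LinearMap.exists_comp_eq_of_injective {U V W : Type*} [AddCommGroup U] [Module R U]
    [AddCommGroup V] [Module R V] [AddCommGroup W] [Module R W]
    (j : U →ₗ[R] V) (hj : Function.Injective j) (f : W →ₗ[R] V)
    (h : ∀ w, ∃ x, j x = f w) : ∃ k : W →ₗ[R] U, j ∘ₗ k = f := by
  refine ⟨(LinearEquiv.ofInjective j hj).symm.toLinearMap ∘ₗ
    f.codRestrict (LinearMap.range j) h, ?_⟩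
  ext w
  have := (LinearEquiv.ofInjective j hj).apply_symm_apply
    (f.codRestrict (LinearMap.range j) h w)
  exact congrArg Subtype.val this

/-- `0 → U → V → W → 0` is exact. -/
structure IsShortExact {U V W : Type*} [AddCommGroup U] [Module R U]
    [AddCommGroup V] [Module R V] [AddCommGroup W] [Module R W]
    (j : U →ₗ[R] V) (q : V →ₗ[R] W) : Prop where
  injective : Function.Injective j
  exact : Function.Exact j q
  surjective : Function.Surjective q

theorem isShortExact_ker {V W : Type*} [AddCommGroup V] [Module R V] [AddCommGroup W] [Module R W]
    (q : V →ₗ[R] W) (hq : Function.Surjective q) :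
    IsShortExact (LinearMap.ker q).subtype q :=
  ⟨Subtype.val_injective, fun x => by simp, hq⟩

theorem isShortExact_mkQ {U V : Type*} [AddCommGroup U] [Module R U] [AddCommGroup V] [Module R V]
    (j : U →ₗ[R] V) (hj : Function.Injective j) :
    IsShortExact j (LinearMap.range j).mkQ :=
  ⟨hj, fun x => by simp, Submodule.mkQ_surjective _⟩

/-! ### Vanishing of the first extension group -/

/-- `Ext¹(G, N) = 0`: a linear map to `N` from the kernel of a surjection `E → G` extends
to `E`. -/
def ExtVanishes (R : Type u) [Ring R] (G N : Type u) [AddCommGroup G] [Module R G]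
    [AddCommGroup N] [Module R N] : Prop :=
  ∀ (K E : Type u) [AddCommGroup K] [Module R K] [AddCommGroup E] [Module R E]
    (j : K →ₗ[R] E) (q : E →ₗ[R] G), IsShortExact j q →
    ∀ f : K →ₗ[R] N, ∃ F : E →ₗ[R] N, F ∘ₗ j = f

variable {G N : Type u} [AddCommGroup G] [Module R G] [AddCommGroup N] [Module R N]

/-- One projective presentation suffices: lifting `q` along `q'` exhibits `E` as the pushout of `K'
← K → P`, so a map on `K'` extends to `E` once its pullback to `K` extends to `P`. -/
theorem ExtVanishes.of_projective {K P : Type u} [AddCommGroup K] [Module R K] [AddCommGroup P]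
    [Module R P] [Module.Projective R P] (j : K →ₗ[R] P) (q : P →ₗ[R] G)
    (hjq : IsShortExact j q) (H : ∀ f : K →ₗ[R] N, ∃ F : P →ₗ[R] N, F ∘ₗ j = f) :
    ExtVanishes R G N := by
  intro K' E _ _ _ _ j' q' h' f
  obtain ⟨s, hs⟩ := Module.projective_lifting_property q' q h'.surjective
  have hs' : ∀ p, q' (s p) = q p := fun p => LinearMap.congr_fun hs p
  obtain ⟨k, hk⟩ := LinearMap.exists_comp_eq_of_injective j' h'.injective (s ∘ₗ j) (by
    intro w
    refine (h'.exact _).1 ?_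
    rw [LinearMap.comp_apply, hs', hjq.exact.apply_apply_eq_zero])
  have hk' : ∀ x, j' (k x) = s (j x) := fun x => LinearMap.congr_fun hk x
  obtain ⟨F₀, hF₀⟩ := H (f ∘ₗ k)
  have hF₀' : ∀ x, F₀ (j x) = f (k x) := fun x => LinearMap.congr_fun hF₀ x
  -- `E` is a quotient of `K' × P`; the map `(f, F₀)` descends because the kernel consists of the
  -- pairs `(-k y, j y)`.
  obtain ⟨F, hF⟩ := LinearMap.exists_comp_eq_of_surjective (j'.coprod s) (by
    intro e
    obtain ⟨p, hp⟩ := hjq.surjective (q' e)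
    obtain ⟨x, hx⟩ := (h'.exact (e - s p)).1 (by rw [map_sub, hs', hp, sub_self])
    exact ⟨(x, p), by simp [hx]⟩) (f.coprod F₀) (by
    rintro ⟨x, p⟩ hxp
    rw [LinearMap.coprod_apply] at hxp ⊢
    have hp : q p = 0 := by
      have := congrArg q' hxp
      rwa [map_add, hs', h'.exact.apply_apply_eq_zero, zero_add, map_zero] at this
    obtain ⟨y, rfl⟩ := (hjq.exact p).1 hp
    have : j' (x + k y) = 0 := by rw [map_add, hk']; exact hxp
    have := h'.injective (this.trans (map_zero j').symm)
    simp only at hxp ⊢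
    rw [hF₀', ← map_add, this, map_zero])
  refine ⟨F, ?_⟩
  ext x
  simpa using LinearMap.congr_fun hF (x, 0)

theorem ExtVanishes.of_equiv {G' : Type u} [AddCommGroup G'] [Module R G'] (e : G ≃ₗ[R] G')
    (h : ExtVanishes R G N) : ExtVanishes R G' N := by
  intro K E _ _ _ _ j q hjq f
  refine h K E j (e.symm.toLinearMap ∘ₗ q) ⟨hjq.injective, ?_, ?_⟩ f
  · intro x
    rw [← hjq.exact x]
    simp
  · exact e.symm.surjective.comp hjq.surjective

theorem ExtVanishes.of_split {N₁ N₂ : Type u} [AddCommGroup N₁] [Module R N₁] [AddCommGroup N₂]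
    [Module R N₂] [Module.Projective R N₂] (j : N₁ →ₗ[R] N) (q : N →ₗ[R] N₂)
    (hjq : IsShortExact j q) (h₁ : ExtVanishes R G N₁) (h₂ : ExtVanishes R G N₂) :
    ExtVanishes R G N := by
  intro K E _ _ _ _ j' q' h' f
  obtain ⟨s, hs⟩ := Module.projective_lifting_property q LinearMap.id hjq.surjective
  have hs' : ∀ x, q (s x) = x := fun x => LinearMap.congr_fun hs x
  obtain ⟨F₂, hF₂⟩ := h₂ K E j' q' h' (q ∘ₗ f)
  obtain ⟨r, hr⟩ := LinearMap.exists_comp_eq_of_injective j hjq.injective (f - s ∘ₗ q ∘ₗ f)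
    (fun w => (hjq.exact _).1 (by simp [hs']))
  obtain ⟨F₁, hF₁⟩ := h₁ K E j' q' h' r
  refine ⟨j ∘ₗ F₁ + s ∘ₗ F₂, ?_⟩
  ext x
  have e₁ := LinearMap.congr_fun hF₁ x
  have e₂ := LinearMap.congr_fun hF₂ x
  have e₃ := LinearMap.congr_fun hr x
  simp only [LinearMap.comp_apply, LinearMap.sub_apply, LinearMap.add_apply] at e₁ e₂ e₃ ⊢
  rw [e₁, e₂, e₃, sub_add_cancel]

end Linear

/-! ### Splicing short exact sequences -/

theorem exists_int_chain {α : Type*} (r : α → α → Prop) (hs : ∀ a, ∃ b, r a b)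
    (hp : ∀ a, ∃ b, r b a) (a : α) : ∃ f : ℤ → α, f 1 = a ∧ ∀ i, r (f i) (f (i + 1)) := by
  choose s hs using hs
  choose p hp using hp
  let f : ℤ → α := fun i => match i with
    | Int.ofNat n => s^[n] a
    | Int.negSucc n => p^[n + 1] a
  have key : ∀ i, r (f i) (f (i + 1)) := by
    intro i
    match i with
    | Int.ofNat n =>
      change r (s^[n] a) (s^[n + 1] a)
      rw [Function.iterate_succ_apply']
      exact hs _
    | Int.negSucc 0 => exact hp a
    | Int.negSucc (n + 1) =>
      change r (p^[n + 1 + 1] a) (p^[n + 1] a)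
      rw [Function.iterate_succ_apply' p (n + 1)]
      exact hp _
  -- The base point is moved to index 1 because the image of `d 0` lies in degree 1.
  refine ⟨fun i => f (i - 1), rfl, fun i => ?_⟩
  have := key (i - 1)
  rwa [show i - 1 + 1 = i + 1 - 1 by ring] at this

section Splice

variable {R : Type u} [Ring R]

/-- Each module of the class is the kernel of a surjection from a projective module onto a module
of the class. -/
def HasProjectiveCosyzygies (c : ModuleCat.{u} R → Prop) : Prop :=
  ∀ G, c G → ∃ (P G' : ModuleCat.{u} R) (j : G →ₗ[R] P) (q : P →ₗ[R] G'),
    Module.Projective R P ∧ c G' ∧ IsShortExact j q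

/-- Each module of the class is a quotient of a projective module by a module of the class. -/
def HasProjectiveSyzygies (c : ModuleCat.{u} R → Prop) : Prop :=
  ∀ G, c G → ∃ (P G' : ModuleCat.{u} R) (j : G' →ₗ[R] P) (q : P →ₗ[R] G),
    Module.Projective R P ∧ c G' ∧ IsShortExact j q

/-- A chain of sequences `0 → T i → P i → T (i + 1) → 0` through `G` at index 1 is spliced; the
image of `d i` is then a copy of `T (i + 1)`. -/
theorem exists_exactProjectiveComplex (c : ModuleCat.{u} R → Prop)
    (hs : HasProjectiveCosyzygies c) (hp : HasProjectiveSyzygies c) (G : ModuleCat.{u} R)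
    (hG : c G) : ∃ C : ExactProjectiveComplex R, Nonempty (G ≃ₗ[R] LinearMap.range (C.d 0)) ∧
      ∀ i, ∃ G', c G' ∧ Nonempty (G' ≃ₗ[R] LinearMap.range (C.d i)) := by
  obtain ⟨T, hT1, hT⟩ := exists_int_chain
    (fun S T : {G : ModuleCat.{u} R // c G} => ∃ (P : ModuleCat.{u} R) (j : S.1 →ₗ[R] P)
      (q : P →ₗ[R] T.1), Module.Projective R P ∧ IsShortExact j q)
    (fun S => by
      obtain ⟨P, G', j, q, h, hc, hjq⟩ := hs S.1 S.2
      exact ⟨⟨G', hc⟩, P, j, q, h, hjq⟩)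
    (fun S => by
      obtain ⟨P, G', j, q, h, hc, hjq⟩ := hp S.1 S.2
      exact ⟨⟨G', hc⟩, P, j, q, h, hjq⟩) ⟨G, hG⟩
  choose P j q hP hjq using hT
  let C : ExactProjectiveComplex R :=
    { P := fun i => P i
      projective := hP
      d := fun i => j (i + 1) ∘ₗ q i
      exact := by
        intro i x
        have h1 := hjq (i + 1)
        have h2 := hjq (i + 1 + 1)
        constructor
        · intro h
          obtain ⟨y, rfl⟩ := (h1.exact x).1 (h2.injective (h.trans (map_zero _).symm))
          obtain ⟨z, rfl⟩ := (hjq i).surjective y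
          exact ⟨z, rfl⟩
        · rintro ⟨z, rfl⟩
          change j (i + 1 + 1) (q (i + 1) (j (i + 1) (q i z))) = 0
          rw [h1.exact.apply_apply_eq_zero, map_zero] }
  have key : ∀ i, Nonempty ((T (i + 1)).1 ≃ₗ[R] LinearMap.range (C.d i)) := fun i =>
    ⟨(LinearEquiv.ofInjective (j (i + 1)) (hjq (i + 1)).injective).trans
      (LinearEquiv.ofEq _ _ (LinearMap.range_comp_of_range_eq_top _
        (LinearMap.range_eq_top.2 (hjq i).surjective)).symm)⟩
  refine ⟨C, ?_, fun i => ⟨_, (T (i + 1)).2, key i⟩⟩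
  obtain ⟨e⟩ := key 0
  have h1 : (T (0 + 1)).1 = G := by rw [zero_add, hT1]
  subst h1
  exact ⟨e⟩

/-! ### Images in an exact complex of projectives -/

namespace ExactProjectiveComplex

theorem isShortExact_range (C : ExactProjectiveComplex R) (i : ℤ) :
    IsShortExact (LinearMap.range (C.d i)).subtype (C.d (i + 1)).rangeRestrict :=
  ⟨Subtype.val_injective, fun x => by
    rw [← LinearMap.mem_ker, LinearMap.ker_rangeRestrict, LinearMap.mem_ker, C.exact i x]
    simp, LinearMap.surjective_rangeRestrict _⟩

/-- A cocycle on `P (i + 1)` is a map on the image of `d (i + 1)`, and `Ext¹` of the next image is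
the obstruction to extending it to `P (i + 1 + 1)`. -/
theorem homExact_of_extVanishes (C : ExactProjectiveComplex R) (N : Type u) [AddCommGroup N]
    [Module R N] (h : ∀ i, ExtVanishes R (LinearMap.range (C.d i)) N) : C.HomExact N := by
  intro i f
  constructor
  · intro hf
    have hf' : ∀ x, f (C.d i x) = 0 := fun x => LinearMap.congr_fun hf x
    obtain ⟨k, hk⟩ := LinearMap.exists_comp_eq_of_surjective (C.d (i + 1)).rangeRestrict
      (LinearMap.surjective_rangeRestrict _) f (by
        intro x hx
        obtain ⟨y, rfl⟩ := (C.exact i x).1 (congrArg Subtype.val hx)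
        exact hf' y)
    obtain ⟨F, hF⟩ := h _ _ _ _ _ (C.isShortExact_range (i + 1)) k
    refine ⟨F, ?_⟩
    rw [← hk, ← hF]
    rfl
  · rintro ⟨F, rfl⟩
    ext x
    change F (C.d (i + 1) (C.d i x)) = 0
    rw [(C.exact i).apply_apply_eq_zero, map_zero]

theorem extVanishes_of_homExact (C : ExactProjectiveComplex R) (N : Type u) [AddCommGroup N]
    [Module R N] (h : C.HomExact N) (i : ℤ) : ExtVanishes R (LinearMap.range (C.d i)) N := by
  obtain ⟨k, rfl⟩ : ∃ k, i = k + 1 + 1 := ⟨i - 2, by ring⟩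
  have := C.projective (k + 1 + 1)
  refine ExtVanishes.of_projective _ _ (C.isShortExact_range (k + 1)) fun f => ?_
  obtain ⟨F, hF⟩ := (h k (f ∘ₗ (C.d (k + 1)).rangeRestrict)).1 (by
    ext x
    have : (C.d (k + 1)).rangeRestrict (C.d k x) = 0 :=
      Subtype.ext ((C.exact k).apply_apply_eq_zero x)
    simp [this])
  refine ⟨F, ?_⟩
  ext ⟨_, x, rfl⟩
  exact LinearMap.congr_fun hF x

theorem hasProjectiveCosyzygies (C : ExactProjectiveComplex R) :
    HasProjectiveCosyzygies fun G : ModuleCat.{u} R => ∃ i, Nonempty (G ≃ₗ[R] LinearMap.range (C.d i)) := by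
  rintro G ⟨i, ⟨e⟩⟩
  have h := C.isShortExact_range i
  refine ⟨ModuleCat.of R (C.P (i + 1)), ModuleCat.of R (LinearMap.range (C.d (i + 1))),
    (LinearMap.range (C.d i)).subtype ∘ₗ e.toLinearMap, (C.d (i + 1)).rangeRestrict,
    C.projective _, ⟨i + 1, ⟨LinearEquiv.refl _ _⟩⟩,
    h.injective.comp e.injective, ?_, h.surjective⟩
  intro x
  rw [h.exact x]
  exact (e.surjective.exists (p := fun y => (y : C.P (i + 1)) = x))

theorem hasProjectiveSyzygies (C : ExactProjectiveComplex R) :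
    HasProjectiveSyzygies fun G : ModuleCat.{u} R => ∃ i, Nonempty (G ≃ₗ[R] LinearMap.range (C.d i)) := by
  rintro G ⟨i, ⟨e⟩⟩
  obtain ⟨i, rfl⟩ : ∃ k, i = k + 1 := ⟨i - 1, by ring⟩
  have h := C.isShortExact_range i
  refine ⟨ModuleCat.of R (C.P (i + 1)), ModuleCat.of R (LinearMap.range (C.d i)),
    (LinearMap.range (C.d i)).subtype, e.symm.toLinearMap ∘ₗ (C.d (i + 1)).rangeRestrict,
    C.projective _, ⟨i, ⟨LinearEquiv.refl _ _⟩⟩, h.injective, ?_,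
    e.symm.surjective.comp h.surjective⟩
  intro x
  rw [← h.exact x]
  simp

end ExactProjectiveComplex

/-! ### The class of Gorenstein projective modules -/

namespace GorensteinProjective

/-- Coinduction principle for Gorenstein projective modules. -/
theorem of_class (c : ModuleCat.{u} R → Prop) (hs : HasProjectiveCosyzygies c)
    (hp : HasProjectiveSyzygies c) (he : ∀ G, c G → ∀ (N : Type u) [AddCommGroup N] [Module R N],
      Module.Projective R N → ExtVanishes R G N) (G : ModuleCat.{u} R) (hG : c G) :
    GorensteinProjective R G := by
  obtain ⟨C, hC, h⟩ := exists_exactProjectiveComplex c hs hp G hG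
  refine ⟨C, fun Q _ _ hQ => C.homExact_of_extVanishes Q fun i => ?_, hC⟩
  obtain ⟨G', hc, ⟨e⟩⟩ := h i
  exact (he G' hc Q hQ).of_equiv e

theorem of_equiv {G G' : Type u} [AddCommGroup G] [Module R G] [AddCommGroup G'] [Module R G']
    (e : G ≃ₗ[R] G') (h : GorensteinProjective R G) : GorensteinProjective R G' := by
  obtain ⟨C, hC, ⟨f⟩⟩ := h
  exact ⟨C, hC, ⟨e.symm.trans f⟩⟩

theorem extVanishes {G : Type u} [AddCommGroup G] [Module R G] (hG : GorensteinProjective R G)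
    {N : Type u} [AddCommGroup N] [Module R N]
    (hN : ∀ C : ExactProjectiveComplex R, C.IsComplete → C.HomExact N) : ExtVanishes R G N := by
  obtain ⟨C, hC, ⟨e⟩⟩ := hG
  exact (C.extVanishes_of_homExact N (hN C hC) 0).of_equiv e.symm

theorem extVanishes_of_projective {G : Type u} [AddCommGroup G] [Module R G]
    (hG : GorensteinProjective R G) {N : Type u} [AddCommGroup N] [Module R N]
    (hN : Module.Projective R N) : ExtVanishes R G N :=
  hG.extVanishes fun _ hC => hC N hN

/-- The coinduction principle is applied to the class of all images of `C`, which avoids reindexing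
the complex. -/
theorem range_d {C : ExactProjectiveComplex R} (hC : C.IsComplete) (G : ModuleCat.{u} R)
    (hG : ∃ i, Nonempty (G ≃ₗ[R] LinearMap.range (C.d i))) : GorensteinProjective R G := by
  refine of_class _ C.hasProjectiveCosyzygies C.hasProjectiveSyzygies ?_ G hG
  rintro G ⟨i, ⟨e⟩⟩ N _ _ hN
  exact (C.extVanishes_of_homExact N (hC N hN) i).of_equiv e.symm

theorem hasProjectiveCosyzygies :
    HasProjectiveCosyzygies fun G : ModuleCat.{u} R => GorensteinProjective R G := by
  rintro G ⟨C, hC, h⟩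
  obtain ⟨P, G', j, q, hP, hG', hjq⟩ := C.hasProjectiveCosyzygies G ⟨0, h⟩
  exact ⟨P, G', j, q, hP, range_d hC G' hG', hjq⟩

theorem hasProjectiveSyzygies :
    HasProjectiveSyzygies fun G : ModuleCat.{u} R => GorensteinProjective R G := by
  rintro G ⟨C, hC, h⟩
  obtain ⟨P, G', j, q, hP, hG', hjq⟩ := C.hasProjectiveSyzygies G ⟨0, h⟩
  exact ⟨P, G', j, q, hP, range_d hC G' hG', hjq⟩

end GorensteinProjective

end Splice

/-! ### Tensoring with a bimodule -/

namespace BimoduleTensor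

variable {A B M : Type u} [Ring A] [Ring B] [AddCommGroup M] [Module A M] [Module Bᵐᵒᵖ M]
  [SMulCommClass A Bᵐᵒᵖ M]
variable {X Y Z W : Type u} [AddCommGroup X] [Module A X] [AddCommGroup Y] [Module B Y]
  [AddCommGroup Z] [Module B Z] [AddCommGroup W] [Module B W]

theorem hom_ext {f g : BimoduleTensor A B M Y →ₗ[A] X}
    (h : ∀ m y, f (tmul A B m y) = g (tmul A B m y)) : f = g := by
  refine Submodule.linearMap_qext _ ?_
  refine TensorProduct.AlgebraTensorModule.ext fun m y => h m y

/-- The `A`-linear map out of `M ⊗_B Y` given by a balanced biadditive map. -/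
def lift (φ : M →ₗ[A] Y →ₗ[ℤ] X)
    (h : ∀ (m : M) (b : B) (y : Y), φ (MulOpposite.op b • m) y = φ m (b • y)) :
    BimoduleTensor A B M Y →ₗ[A] X :=
  (balancedRelations A B M Y).liftQ (TensorProduct.AlgebraTensorModule.lift φ) (by
    rw [balancedRelations, Submodule.span_le]
    rintro _ ⟨m, b, y, rfl⟩
    simp [h])

@[simp]
theorem lift_tmul (φ : M →ₗ[A] Y →ₗ[ℤ] X)
    (h : ∀ (m : M) (b : B) (y : Y), φ (MulOpposite.op b • m) y = φ m (b • y)) (m : M) (y : Y) :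
    lift φ h (tmul A B m y) = φ m y := by
  simp [lift, tmul]

theorem map_comp (f : Y →ₗ[B] Z) (g : Z →ₗ[B] W) :
    map A B M (g ∘ₗ f) = map A B M g ∘ₗ map A B M f :=
  hom_ext fun _ _ => rfl

theorem map_map (f : Y →ₗ[B] Z) (g : Z →ₗ[B] W) (t : BimoduleTensor A B M Y) :
    map A B M g (map A B M f t) = map A B M (g ∘ₗ f) t := by
  rw [map_comp, LinearMap.comp_apply]

theorem tmul_zero (m : M) : tmul A B m (0 : Y) = 0 := by simp [tmul]

theorem zero_tmul (y : Y) : tmul A B (0 : M) y = 0 := by simp [tmul]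

@[simp]
theorem map_zeroMap : map A B M (0 : Y →ₗ[B] Z) = 0 :=
  hom_ext fun m y => by rw [map_tmul, LinearMap.zero_apply, LinearMap.zero_apply, tmul_zero]

@[simp]
theorem map_id : map A B M (LinearMap.id : Y →ₗ[B] Y) = LinearMap.id :=
  hom_ext fun _ _ => rfl

theorem map_negMap (f : Y →ₗ[B] Z) : map A B M (-f) = -map A B M f :=
  hom_ext fun m y => by
    rw [LinearMap.neg_apply, map_tmul, map_tmul, LinearMap.neg_apply, eq_neg_iff_add_eq_zero,
      ← tmul_add, neg_add_cancel, tmul_zero]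

theorem map_surjective (f : Y →ₗ[B] Z) (hf : Function.Surjective f) :
    Function.Surjective (map A B M f) := by
  intro t
  obtain ⟨t, rfl⟩ := Submodule.mkQ_surjective _ t
  obtain ⟨s, rfl⟩ := LinearMap.lTensor_surjective M
    (g := f.toAddMonoidHom.toIntLinearMap) hf t
  exact ⟨(balancedRelations A B M Y).mkQ s, rfl⟩

/-- A generating relation involves a single element of `Z`, and any preimage of it gives a relation
over `Y`. This lets right exactness of the tensor product over `ℤ` pass to the balanced quotient. -/
theorem exists_lift_balancedRelations (f : Y →ₗ[B] Z) (hf : Function.Surjective f)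
    {t : M ⊗[ℤ] Z} (ht : t ∈ balancedRelations A B M Z) :
    ∃ s ∈ balancedRelations A B M Y,
      LinearMap.lTensor M f.toAddMonoidHom.toIntLinearMap s = t := by
  refine Submodule.span_induction (p := fun t _ => ∃ s ∈ balancedRelations A B M Y,
      LinearMap.lTensor M f.toAddMonoidHom.toIntLinearMap s = t) ?_ ?_ ?_ ?_ ht
  · rintro _ ⟨m, b, z, rfl⟩
    obtain ⟨y, rfl⟩ := hf z
    exact ⟨_, Submodule.subset_span ⟨m, b, y, rfl⟩, by simp⟩
  · exact ⟨0, zero_mem _, map_zero _⟩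
  · rintro _ _ _ _ ⟨s, hs, rfl⟩ ⟨s', hs', rfl⟩
    exact ⟨s + s', add_mem hs hs', map_add _ _ _⟩
  · rintro a _ _ ⟨s, hs, rfl⟩
    exact ⟨a • s, Submodule.smul_mem _ _ hs, (TensorProduct.AlgebraTensorModule.map
      (LinearMap.id : M →ₗ[A] M) f.toAddMonoidHom.toIntLinearMap).map_smul a s⟩

/-- The functor `M ⊗_B -` is right exact. -/
theorem map_exact (f : Y →ₗ[B] Z) (g : Z →ₗ[B] W) (hfg : Function.Exact f g)
    (hg : Function.Surjective g) : Function.Exact (map A B M f) (map A B M g) := by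
  intro t
  constructor
  · intro ht
    obtain ⟨t, rfl⟩ := Submodule.mkQ_surjective _ t
    have ht' : LinearMap.lTensor M g.toAddMonoidHom.toIntLinearMap t
        ∈ balancedRelations A B M W := (Submodule.Quotient.mk_eq_zero _).1 ht
    -- Subtracting the relation `r` moves `t` into the kernel over `ℤ` without changing its class.
    obtain ⟨r, hr, hrt⟩ := exists_lift_balancedRelations g hg ht'
    obtain ⟨s, hs⟩ := (lTensor_exact M (f := f.toAddMonoidHom.toIntLinearMap)
      (g := g.toAddMonoidHom.toIntLinearMap) hfg hg (t - r)).1 (by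
        rw [map_sub, hrt, sub_self])
    refine ⟨(balancedRelations A B M Y).mkQ s, ?_⟩
    change (balancedRelations A B M Z).mkQ
      (LinearMap.lTensor M f.toAddMonoidHom.toIntLinearMap s) = _
    rw [hs, map_sub, (Submodule.mkQ_apply _ r).trans ((Submodule.Quotient.mk_eq_zero _).2 hr), sub_zero]
  · rintro ⟨s, rfl⟩
    rw [map_map, LinearMap.ext (f := g ∘ₗ f) (g := 0) fun x => hfg.apply_apply_eq_zero x, map_zeroMap,
      LinearMap.zero_apply]

variable (A M) in
/-- If `Q` is projective over `B`, then `M ⊗_B Q` belongs to `Add M`. -/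
theorem memAdd (Q : Type u) [AddCommGroup Q] [Module B Q] [Module.Projective B Q] :
    MemAdd A M (BimoduleTensor A B M Q) := by
  obtain ⟨s, hs⟩ := Module.projective_def'.1 (inferInstance : Module.Projective B Q)
  -- A section `s` of the free cover of `Q` indexed by `Q` itself induces `m ⊗ y ↦ (m · s(y)_i)_i`;
  -- the retraction `ψ` sends `m` at index `i` to `m ⊗ i`.
  let φ : M →ₗ[A] Q →ₗ[ℤ] (Q →₀ M) :=
    { toFun := fun m => AddMonoidHom.toIntLinearMap
        { toFun := fun y => (s y).mapRange (fun b => MulOpposite.op b • m) (by simp)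
          map_zero' := by ext; simp
          map_add' := fun y z => by ext; simp [add_smul] }
      map_add' := fun m m' => by ext; simp
      map_smul' := fun a m => by ext; simp [smul_comm] }
  have hφ : ∀ m y, φ m y = (s y).mapRange (fun b => MulOpposite.op b • m) (by simp) :=
    fun _ _ => rfl
  let ψ : Q → M →ₗ[A] BimoduleTensor A B M Q := fun y =>
    { toFun := fun m => tmul A B m y
      map_add' := fun m m' => add_tmul m m' y
      map_smul' := fun a m => (smul_tmul a m y).symm }
  refine ⟨Q, lift φ fun m b y => by ext; simp [hφ, mul_smul], Finsupp.lsum ℕ ψ, ?_⟩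
  refine hom_ext fun m y => ?_
  rw [LinearMap.comp_apply, lift_tmul, hφ, Finsupp.lsum_apply,
    Finsupp.sum_mapRange_index (fun _ => LinearMap.map_zero _), LinearMap.id_apply]
  have hy : (s y).sum (fun i b => b • i) = y := LinearMap.congr_fun hs y
  conv_rhs => rw [← hy]
  let τ : Q →+ BimoduleTensor A B M Q :=
    { toFun := fun y => tmul A B m y
      map_zero' := tmul_zero m
      map_add' := tmul_add m }
  change _ = τ _
  rw [map_finsuppSum]
  refine Finsupp.sum_congr fun i _ => ?_
  exact (tmul_smul m _ i).symm

end BimoduleTensor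

/-! ### Vanishing of the first torsion group -/

section Tor

variable (A B M : Type u) [Ring A] [Ring B] [AddCommGroup M] [Module A M] [Module Bᵐᵒᵖ M]
  [SMulCommClass A Bᵐᵒᵖ M]

/-- `Tor₁(M, Y) = 0`: tensoring with `M` preserves the injectivity of the kernel of any
surjection onto `Y`. -/
def TorVanishes (Y : Type u) [AddCommGroup Y] [Module B Y] : Prop :=
  ∀ (K E : Type u) [AddCommGroup K] [Module B K] [AddCommGroup E] [Module B E]
    (j : K →ₗ[B] E) (q : E →ₗ[B] Y), IsShortExact j q →
    Function.Injective (BimoduleTensor.map A B M j)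

/-- Tensoring with `M` preserves the exactness of exact complexes of projective modules. -/
def TensorPreservesExact : Prop :=
  ∀ (C : ExactProjectiveComplex B) (i : ℤ), Function.Exact
    (BimoduleTensor.map A B M (C.d i)) (BimoduleTensor.map A B M (C.d (i + 1)))

/-- `Hom_A(P•, N)` is exact for every complete projective resolution `P•` and every `N` in
`Add M`. -/
def AddHomExact : Prop :=
  ∀ C : ExactProjectiveComplex A, C.IsComplete →
    ∀ (N : Type u) [AddCommGroup N] [Module A N], MemAdd A M N → C.HomExact N

variable {A B M} {Y : Type u} [AddCommGroup Y] [Module B Y]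

open BimoduleTensor in
theorem TorVanishes.of_projective {K P : Type u} [AddCommGroup K] [Module B K] [AddCommGroup P]
    [Module B P] [Module.Projective B P] (j : K →ₗ[B] P) (q : P →ₗ[B] Y) (hjq : IsShortExact j q)
    (H : Function.Injective (BimoduleTensor.map A B M j)) : TorVanishes A B M Y := by
  intro K' E _ _ _ _ j' q' h'
  obtain ⟨s, hs⟩ := Module.projective_lifting_property q' q h'.surjective
  have hs' : ∀ p, q' (s p) = q p := fun p => LinearMap.congr_fun hs p
  obtain ⟨k, hk⟩ := LinearMap.exists_comp_eq_of_injective j' h'.injective (s ∘ₗ j) (by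
    intro w
    refine (h'.exact _).1 ?_
    rw [LinearMap.comp_apply, hs', hjq.exact.apply_apply_eq_zero])
  have hk' : ∀ x, j' (k x) = s (j x) := fun x => LinearMap.congr_fun hk x
  -- The pushout description of `E` as an exact sequence `K → K' × P → E → 0`, which tensoring
  -- preserves.
  have hex : Function.Exact (k.prod (-j)) (j'.coprod s) := by
    rintro ⟨x, p⟩
    constructor
    · intro hxp
      rw [LinearMap.coprod_apply] at hxp
      have hp : q p = 0 := by
        have := congrArg q' hxp
        rwa [map_add, hs', h'.exact.apply_apply_eq_zero, zero_add, LinearMap.map_zero] at this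
      obtain ⟨y, rfl⟩ := (hjq.exact p).1 hp
      refine ⟨-y, Prod.ext (h'.injective ?_) (by simp)⟩
      change j' (k (-y)) = j' x
      rw [map_neg, map_neg, hk']
      exact (eq_neg_of_add_eq_zero_left hxp).symm
    · rintro ⟨y, hy⟩
      rw [← hy]
      simp [hk']
  have hsurj : Function.Surjective (j'.coprod s) := by
    intro e
    obtain ⟨p, hp⟩ := hjq.surjective (q' e)
    obtain ⟨x, hx⟩ := (h'.exact (e - s p)).1 (by rw [map_sub, hs', hp, sub_self])
    exact ⟨(x, p), by simp [hx]⟩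
  have hT := map_exact (A := A) (M := M) _ _ hex hsurj
  rw [injective_iff_map_eq_zero]
  intro z hz
  obtain ⟨w, hw⟩ := (hT (map A B M (LinearMap.inl B K' P) z)).1 (by
    rw [map_map, LinearMap.coprod_inl, hz])
  -- The `P`-component of the image of `w` is `-(M ⊗ j) w`, and it is zero; `H` then kills `w`,
  -- hence also `z`.
  have hw₂ := congrArg (map A B M (LinearMap.snd B K' P)) hw
  rw [map_map, map_map, LinearMap.snd_prod, LinearMap.snd_comp_inl, map_zeroMap,
    LinearMap.zero_apply, map_negMap, LinearMap.neg_apply, neg_eq_zero] at hw₂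
  rw [(injective_iff_map_eq_zero _).1 H w hw₂, LinearMap.map_zero] at hw
  have hw₁ := congrArg (map A B M (LinearMap.fst B K' P)) hw
  rwa [map_map, LinearMap.fst_comp_inl, map_id, LinearMap.map_zero, eq_comm] at hw₁

theorem TorVanishes.of_equiv {Y' : Type u} [AddCommGroup Y'] [Module B Y'] (e : Y ≃ₗ[B] Y')
    (h : TorVanishes A B M Y) : TorVanishes A B M Y' := by
  intro K E _ _ _ _ j q hjq
  refine h K E j (e.symm.toLinearMap ∘ₗ q) ⟨hjq.injective, ?_, e.symm.surjective.comp hjq.surjective⟩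
  intro x
  rw [← hjq.exact x]
  simp

open BimoduleTensor in
-- An element of `M ⊗ Im d` killed in the next term lifts to a cycle of the tensored complex;
-- exactness makes it a boundary, which dies in `M ⊗ Im d`.
theorem ExactProjectiveComplex.torVanishes (C : ExactProjectiveComplex B)
    (hC : ∀ i, Function.Exact (BimoduleTensor.map A B M (C.d i))
      (BimoduleTensor.map A B M (C.d (i + 1)))) (i : ℤ) :
    TorVanishes A B M (LinearMap.range (C.d i)) := by
  obtain ⟨k, rfl⟩ : ∃ k, i = k + 1 + 1 := ⟨i - 2, by ring⟩
  have := C.projective (k + 1 + 1)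
  refine TorVanishes.of_projective _ _ (C.isShortExact_range (k + 1)) ?_
  rw [injective_iff_map_eq_zero]
  intro t ht
  obtain ⟨t, rfl⟩ := map_surjective _ (LinearMap.surjective_rangeRestrict (C.d (k + 1))) t
  rw [map_map, LinearMap.subtype_comp_codRestrict] at ht
  obtain ⟨r, rfl⟩ := (hC k t).1 ht
  rw [map_map, LinearMap.ext (f := (C.d (k + 1)).rangeRestrict ∘ₗ C.d k) (g := 0)
    fun x => Subtype.ext ((C.exact k).apply_apply_eq_zero x), map_zeroMap, LinearMap.zero_apply]

theorem torVanishes_of_class (hB : TensorPreservesExact A B M)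
    (c : ModuleCat.{u} B → Prop) (hs : HasProjectiveCosyzygies c) (hp : HasProjectiveSyzygies c)
    (Y : ModuleCat.{u} B) (hY : c Y) : TorVanishes A B M Y := by
  obtain ⟨C, ⟨e⟩, -⟩ := exists_exactProjectiveComplex c hs hp Y hY
  exact (C.torVanishes (hB C) 0).of_equiv e.symm

theorem GorensteinProjective.torVanishes (hB : TensorPreservesExact A B M)
    (hY : GorensteinProjective B Y) : TorVanishes A B M Y := by
  obtain ⟨C, -, ⟨e⟩⟩ := hY
  exact (C.torVanishes (hB C) 0).of_equiv e.symm

theorem GorensteinProjective.extVanishes_tensor {G : Type u} [AddCommGroup G] [Module A G]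
    (hG : GorensteinProjective A G) (hA : AddHomExact A M) (Q : Type u) [AddCommGroup Q]
    [Module B Q] [Module.Projective B Q] : ExtVanishes A G (BimoduleTensor A B M Q) :=
  hG.extVanishes fun C hC => hA C hC _ (BimoduleTensor.memAdd A M Q)

end Tor

/-! ### Modules over the triangular matrix ring -/

namespace TripleModule

variable {A B M : Type u} [Ring A] [Ring B] [AddCommGroup M] [Module A M] [Module Bᵐᵒᵖ M]
  [SMulCommClass A Bᵐᵒᵖ M]

section Hom

variable {X Y X' Y' X'' Y'' : Type u} [AddCommGroup X] [Module A X] [AddCommGroup Y] [Module B Y]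
  [AddCommGroup X'] [Module A X'] [AddCommGroup Y'] [Module B Y']
  [AddCommGroup X''] [Module A X''] [AddCommGroup Y''] [Module B Y'']
  {g : BimoduleTensor A B M Y →ₗ[A] X} {g' : BimoduleTensor A B M Y' →ₗ[A] X'}
  {g'' : BimoduleTensor A B M Y'' →ₗ[A] X''}

variable (g) in
/-- The column with entries `x` and `y`. -/
def mk (x : X) (y : Y) : TripleModule g := (x, y)

theorem smul_mk (t : TriangularMatrixRing A B M) (x : X) (y : Y) :
    t • mk g x y = mk g (t.a • x + g (BimoduleTensor.tmul A B t.m y)) (t.b • y) := rfl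

/-- The linear map of triples with components `a` and `b`. -/
def hom (a : X →ₗ[A] X') (b : Y →ₗ[B] Y') (h : a ∘ₗ g = g' ∘ₗ BimoduleTensor.map A B M b) :
    TripleModule g →ₗ[TriangularMatrixRing A B M] TripleModule g' where
  toFun v := mk g' (a v.1) (b v.2)
  map_add' v w := Prod.ext (map_add a v.1 w.1) (map_add b v.2 w.2)
  map_smul' t v := by
    refine Prod.ext ?_ (map_smul b t.b v.2)
    change a (t.a • v.1 + g (BimoduleTensor.tmul A B t.m v.2))
      = t.a • a v.1 + g' (BimoduleTensor.tmul A B t.m (b v.2))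
    rw [map_add, map_smul, ← BimoduleTensor.map_tmul]
    exact congrArg _ (LinearMap.congr_fun h _)

@[simp]
theorem hom_mk (a : X →ₗ[A] X') (b : Y →ₗ[B] Y')
    (h : a ∘ₗ g = g' ∘ₗ BimoduleTensor.map A B M b) (x : X) (y : Y) :
    hom a b h (mk g x y) = mk g' (a x) (b y) := rfl

theorem exists_mk (v : TripleModule g) : ∃ x y, v = mk g x y := ⟨v.1, v.2, rfl⟩

theorem mk_inj {x x' : X} {y y' : Y} : mk g x y = mk g x' y' ↔ x = x' ∧ y = y' := Prod.mk_inj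

theorem mk_zero : mk g 0 0 = 0 := rfl

theorem mk_add_mk (x x' : X) (y y' : Y) : mk g x y + mk g x' y' = mk g (x + x') (y + y') := rfl

/-- Every linear map of triples is given by its two components. -/
theorem exists_eq_hom (φ : TripleModule g →ₗ[TriangularMatrixRing A B M] TripleModule g') :
    ∃ (a : X →ₗ[A] X') (b : Y →ₗ[B] Y') (h : a ∘ₗ g = g' ∘ₗ BimoduleTensor.map A B M b),
      φ = hom a b h := by
  -- Commuting with the diagonal idempotents forces `φ` to preserve the two components.
  have h₁ : ∀ x, φ (mk g x 0) = mk g' (φ (mk g x 0)).1 0 := by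
    intro x
    have := φ.map_smul ⟨1, 0, 0⟩ (mk g x 0)
    rw [smul_mk] at this
    simp only [one_smul, BimoduleTensor.zero_tmul, map_zero, add_zero, smul_zero] at this
    exact Prod.ext rfl ((congrArg Prod.snd this).trans (zero_smul B _))
  have h₂ : ∀ y, φ (mk g 0 y) = mk g' 0 (φ (mk g 0 y)).2 := by
    intro y
    have := φ.map_smul ⟨0, 0, 1⟩ (mk g 0 y)
    rw [smul_mk] at this
    simp only [one_smul, BimoduleTensor.zero_tmul, map_zero, add_zero, smul_zero] at this
    refine Prod.ext ((congrArg Prod.fst this).trans ?_) rfl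
    change (0 : A) • _ + g' (BimoduleTensor.tmul A B 0 _) = 0
    rw [zero_smul, BimoduleTensor.zero_tmul, map_zero, add_zero]
  let a : X →ₗ[A] X' :=
    { toFun := fun x => (φ (mk g x 0)).1
      map_add' := fun x x' => by
        have : φ (mk g (x + x') 0) = φ (mk g x 0) + φ (mk g x' 0) := by
          rw [← map_add, mk_add_mk, add_zero]
        exact congrArg Prod.fst this
      map_smul' := fun r x => by
        have := congrArg Prod.fst (φ.map_smul ⟨r, 0, 0⟩ (mk g x 0))
        rw [h₁ x, smul_mk, smul_mk] at this
        simp only [BimoduleTensor.zero_tmul, map_zero, add_zero, smul_zero] at this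
        exact this }
  let b : Y →ₗ[B] Y' :=
    { toFun := fun y => (φ (mk g 0 y)).2
      map_add' := fun y y' => by
        have : φ (mk g 0 (y + y')) = φ (mk g 0 y) + φ (mk g 0 y') := by
          rw [← map_add, mk_add_mk, add_zero]
        exact congrArg Prod.snd this
      map_smul' := fun r y => by
        have := congrArg Prod.snd (φ.map_smul ⟨0, 0, r⟩ (mk g 0 y))
        rw [smul_mk] at this
        simp only [BimoduleTensor.zero_tmul, map_zero, add_zero, smul_zero] at this
        exact this }
  refine ⟨a, b, ?_, ?_⟩
  · refine BimoduleTensor.hom_ext fun m y => ?_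
    -- The strictly upper triangular matrices act through the structure maps, so linearity over them
    -- is the compatibility square.
    have := congrArg Prod.fst (φ.map_smul ⟨0, m, 0⟩ (mk g 0 y))
    rw [h₂ y, smul_mk, smul_mk] at this
    simp only [zero_add, zero_smul] at this
    exact this
  · ext v
    obtain ⟨x, y, rfl⟩ := exists_mk v
    have : mk g x y = mk g x 0 + mk g 0 y := by rw [mk_add_mk, add_zero, zero_add]
    rw [this, map_add, h₁, h₂, map_add, mk_add_mk, hom_mk, hom_mk, mk_add_mk, map_zero, map_zero]
    rfl

variable {a : X →ₗ[A] X'} {b : Y →ₗ[B] Y'} {h : a ∘ₗ g = g' ∘ₗ BimoduleTensor.map A B M b}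
  {a' : X' →ₗ[A] X''} {b' : Y' →ₗ[B] Y''} {h' : a' ∘ₗ g' = g'' ∘ₗ BimoduleTensor.map A B M b'}

theorem isShortExact_hom_iff :
    IsShortExact (hom a b h) (hom a' b' h') ↔ IsShortExact a a' ∧ IsShortExact b b' := by
  constructor
  · intro H
    refine ⟨⟨?_, ?_, ?_⟩, ⟨?_, ?_, ?_⟩⟩
    · intro x x' hx
      exact (mk_inj.1 (H.injective (show hom a b h (mk g x 0) = hom a b h (mk g x' 0) by
        rw [hom_mk, hom_mk, hx]))).1
    · intro x
      constructor
      · intro hx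
        obtain ⟨v, hv⟩ := (H.exact (mk g' x 0)).1 (by rw [hom_mk, hx, map_zero, mk_zero])
        exact ⟨v.1, congrArg Prod.fst hv⟩
      · rintro ⟨x, rfl⟩
        exact congrArg Prod.fst (H.exact.apply_apply_eq_zero (mk g x 0))
    · intro x
      obtain ⟨v, hv⟩ := H.surjective (mk g'' x 0)
      exact ⟨v.1, congrArg Prod.fst hv⟩
    · intro y y' hy
      exact (mk_inj.1 (H.injective (show hom a b h (mk g 0 y) = hom a b h (mk g 0 y') by
        rw [hom_mk, hom_mk, hy]))).2
    · intro y
      constructor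
      · intro hy
        obtain ⟨v, hv⟩ := (H.exact (mk g' 0 y)).1 (by rw [hom_mk, hy, map_zero, mk_zero])
        exact ⟨v.2, congrArg Prod.snd hv⟩
      · rintro ⟨y, rfl⟩
        exact congrArg Prod.snd (H.exact.apply_apply_eq_zero (mk g 0 y))
    · intro y
      obtain ⟨v, hv⟩ := H.surjective (mk g'' 0 y)
      exact ⟨v.2, congrArg Prod.snd hv⟩
  · rintro ⟨H₁, H₂⟩
    refine ⟨?_, ?_, ?_⟩
    · intro v w hvw
      exact Prod.ext (H₁.injective (congrArg Prod.fst hvw)) (H₂.injective (congrArg Prod.snd hvw))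
    · intro v
      constructor
      · intro hv
        obtain ⟨x, hx⟩ := (H₁.exact v.1).1 (congrArg Prod.fst hv)
        obtain ⟨y, hy⟩ := (H₂.exact v.2).1 (congrArg Prod.snd hv)
        exact ⟨mk g x y, Prod.ext hx hy⟩
      · rintro ⟨v, rfl⟩
        exact Prod.ext (H₁.exact.apply_apply_eq_zero v.1) (H₂.exact.apply_apply_eq_zero v.2)
    · intro v
      obtain ⟨x, hx⟩ := H₁.surjective v.1
      obtain ⟨y, hy⟩ := H₂.surjective v.2
      exact ⟨mk g' x y, Prod.ext hx hy⟩

theorem hom_surjective (ha : Function.Surjective a) (hb : Function.Surjective b) :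
    Function.Surjective (hom a b h) := fun v => by
  obtain ⟨x, hx⟩ := ha v.1
  obtain ⟨y, hy⟩ := hb v.2
  exact ⟨mk g x y, Prod.ext hx hy⟩

end Hom

/-! ### Decomposition of a module by the diagonal idempotents -/

section Equiv

variable (A B M) (V : Type u) [AddCommGroup V] [Module (TriangularMatrixRing A B M) V]

open TriangularMatrixRing

/-- The upper part of a module over the triangular matrix ring. -/
def upper : AddSubgroup V where
  carrier := {v | (⟨1, 0, 0⟩ : TriangularMatrixRing A B M) • v = v}
  add_mem' {v w} hv hw := by
    change _ • (v + w) = v + w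
    rw [smul_add, show _ • v = v from hv, show _ • w = w from hw]
  zero_mem' := smul_zero _
  neg_mem' {v} hv := by
    change _ • (-v) = -v
    rw [smul_neg, show _ • v = v from hv]

/-- The lower part of a module over the triangular matrix ring. -/
def lower : AddSubgroup V where
  carrier := {v | (⟨0, 0, 1⟩ : TriangularMatrixRing A B M) • v = v}
  add_mem' {v w} hv hw := by
    change _ • (v + w) = v + w
    rw [smul_add, show _ • v = v from hv, show _ • w = w from hw]
  zero_mem' := smul_zero _
  neg_mem' {v} hv := by
    change _ • (-v) = -v
    rw [smul_neg, show _ • v = v from hv]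

variable {A B M V}

theorem mem_upper_iff {v : V} :
    v ∈ upper A B M V ↔ (⟨1, 0, 0⟩ : TriangularMatrixRing A B M) • v = v := Iff.rfl

theorem mem_lower_iff {v : V} :
    v ∈ lower A B M V ↔ (⟨0, 0, 1⟩ : TriangularMatrixRing A B M) • v = v := Iff.rfl

theorem smul_mem_upper (a : A) (m : M) (v : V) :
    (⟨a, m, 0⟩ : TriangularMatrixRing A B M) • v ∈ upper A B M V := by
  rw [mem_upper_iff, ← mul_smul]
  congr 1
  ext <;> simp

theorem smul_mem_lower (b : B) (v : V) :
    (⟨0, 0, b⟩ : TriangularMatrixRing A B M) • v ∈ lower A B M V := by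
  rw [mem_lower_iff, ← mul_smul]
  congr 1
  ext <;> simp

instance : Module A (upper A B M V) where
  smul a v := ⟨(⟨a, 0, 0⟩ : TriangularMatrixRing A B M) • (v : V), smul_mem_upper a 0 _⟩
  one_smul v := Subtype.ext v.2
  mul_smul a b v := Subtype.ext (by
    change _ • (v : V) = _ • _ • (v : V)
    rw [← mul_smul]
    congr 1
    ext <;> simp)
  smul_zero a := Subtype.ext (smul_zero _)
  smul_add a v w := Subtype.ext (smul_add _ _ _)
  add_smul a b v := Subtype.ext (by
    change _ • (v : V) = _ • (v : V) + _ • (v : V)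
    rw [← add_smul]
    congr 1
    ext <;> simp)
  zero_smul v := Subtype.ext (zero_smul (TriangularMatrixRing A B M) (v : V))

instance : Module B (lower A B M V) where
  smul b v := ⟨(⟨0, 0, b⟩ : TriangularMatrixRing A B M) • (v : V), smul_mem_lower b _⟩
  one_smul v := Subtype.ext v.2
  mul_smul a b v := Subtype.ext (by
    change _ • (v : V) = _ • _ • (v : V)
    rw [← mul_smul]
    congr 1
    ext <;> simp)
  smul_zero a := Subtype.ext (smul_zero _)
  smul_add a v w := Subtype.ext (smul_add _ _ _)
  add_smul a b v := Subtype.ext (by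
    change _ • (v : V) = _ • (v : V) + _ • (v : V)
    rw [← add_smul]
    congr 1
    ext <;> simp)
  zero_smul v := Subtype.ext (zero_smul (TriangularMatrixRing A B M) (v : V))

variable (A B M V) in
/-- The structure map `M ⊗_B V₂ → V₁` of a module over the triangular matrix ring. -/
def structureMap : BimoduleTensor A B M (lower A B M V) →ₗ[A] upper A B M V :=
  BimoduleTensor.lift
    { toFun := fun m => AddMonoidHom.toIntLinearMap
        { toFun := fun y => ⟨(⟨0, m, 0⟩ : TriangularMatrixRing A B M) • (y : V),
            smul_mem_upper 0 m _⟩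
          map_zero' := Subtype.ext (smul_zero _)
          map_add' := fun _ _ => Subtype.ext (smul_add _ _ _) }
      map_add' := fun m m' => by
        ext y
        change _ • (y : V) = _ • (y : V) + _ • (y : V)
        rw [← add_smul]
        congr 1
        ext <;> simp
      map_smul' := fun a m => by
        ext y
        change _ • (y : V) = _ • _ • (y : V)
        rw [← mul_smul]
        congr 1
        ext <;> simp }
    (fun m b y => Subtype.ext (by
      change _ • (y : V) = _ • _ • (y : V)
      rw [← mul_smul]
      congr 1
      ext <;> simp))

theorem coe_structureMap_tmul (m : M) (y : lower A B M V) :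
    (structureMap A B M V (BimoduleTensor.tmul A B m y) : V)
      = (⟨0, m, 0⟩ : TriangularMatrixRing A B M) • (y : V) := by
  rw [structureMap, BimoduleTensor.lift_tmul]
  rfl

variable (A B M V) in
/-- Every module over the triangular matrix ring is given by a triple. -/
def equivTriple : V ≃ₗ[TriangularMatrixRing A B M] TripleModule (structureMap A B M V) where
  toFun v := mk _ ⟨(⟨1, 0, 0⟩ : TriangularMatrixRing A B M) • v, smul_mem_upper 1 0 v⟩
    ⟨(⟨0, 0, 1⟩ : TriangularMatrixRing A B M) • v, smul_mem_lower 1 v⟩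
  invFun v := v.1.1 + v.2.1
  map_add' v w := Prod.ext (Subtype.ext (smul_add _ v w)) (Subtype.ext (smul_add _ v w))
  map_smul' t v := by
    refine Prod.ext (Subtype.ext ?_) (Subtype.ext ?_)
    · change _ • t • v = _ • _ • v + (structureMap A B M V (BimoduleTensor.tmul A B t.m _) : V)
      rw [coe_structureMap_tmul]
      change _ = _ + _ • _ • v
      rw [← mul_smul, ← mul_smul, ← mul_smul, ← add_smul]
      congr 1
      ext <;> simp
    · change _ • t • v = _ • _ • v
      rw [← mul_smul, ← mul_smul]
      congr 1
      ext <;> simp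
  left_inv v := by
    change (⟨1, 0, 0⟩ : TriangularMatrixRing A B M) • v
      + (⟨0, 0, 1⟩ : TriangularMatrixRing A B M) • v = v
    rw [← add_smul]
    conv_rhs => rw [← one_smul (TriangularMatrixRing A B M) v]
    congr 1
    ext <;> simp
  right_inv v := by
    refine Prod.ext (Subtype.ext ?_) (Subtype.ext ?_)
    · change _ • (v.1.1 + v.2.1) = v.1.1
      -- The two idempotents are orthogonal, so the other summand is annihilated.
      rw [smul_add, mem_upper_iff.1 v.1.2, ← mem_lower_iff.1 v.2.2, ← mul_smul]
      convert add_zero _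
      convert zero_smul (TriangularMatrixRing A B M) _
      ext <;> simp
    · change _ • (v.1.1 + v.2.1) = v.2.1
      rw [smul_add, mem_lower_iff.1 v.2.2, ← mem_upper_iff.1 v.1.2, ← mul_smul]
      convert zero_add _
      convert zero_smul (TriangularMatrixRing A B M) _
      ext <;> simp

end Equiv

/-! ### Projective triples -/

section Projective

variable {X Y : Type u} [AddCommGroup X] [Module A X] [AddCommGroup Y] [Module B Y]
  {g : BimoduleTensor A B M Y →ₗ[A] X}

theorem exists_section {X' Y' : Type u} [AddCommGroup X'] [Module A X'] [AddCommGroup Y']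
    [Module B Y'] {g' : BimoduleTensor A B M Y' →ₗ[A] X'}
    (hg : Module.Projective (TriangularMatrixRing A B M) (TripleModule g))
    (a : X' →ₗ[A] X) (b : Y' →ₗ[B] Y) (h : a ∘ₗ g' = g ∘ₗ BimoduleTensor.map A B M b)
    (ha : Function.Surjective a) (hb : Function.Surjective b) :
    ∃ (s : X →ₗ[A] X') (t : Y →ₗ[B] Y'), s ∘ₗ g = g' ∘ₗ BimoduleTensor.map A B M t ∧
      a ∘ₗ s = LinearMap.id ∧ b ∘ₗ t = LinearMap.id := by
  obtain ⟨σ, hσ⟩ := Module.projective_lifting_property (hom a b h) LinearMap.id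
    (hom_surjective ha hb)
  obtain ⟨s, t, hst, rfl⟩ := exists_eq_hom σ
  refine ⟨s, t, hst, ?_, ?_⟩
  · ext x
    exact congrArg Prod.fst (LinearMap.congr_fun hσ (mk g x 0))
  · ext y
    exact congrArg Prod.snd (LinearMap.congr_fun hσ (mk g 0 y))

theorem projective_snd (hg : Module.Projective (TriangularMatrixRing A B M) (TripleModule g)) :
    Module.Projective B Y := by
  have hq : Function.Surjective (Finsupp.linearCombination B (id : Y → Y)) :=
    Finsupp.linearCombination_id_surjective B Y
  -- The cover keeps `X` and replaces `Y` by a free module.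
  obtain ⟨s, t, -, -, ht⟩ := exists_section
    (g' := g ∘ₗ BimoduleTensor.map A B M (Finsupp.linearCombination B (id : Y → Y))) hg
    LinearMap.id (Finsupp.linearCombination B (id : Y → Y)) rfl Function.surjective_id hq
  exact Module.projective_def'.2 ⟨t, ht⟩

/-- The triple is covered by `(X ⊕ M ⊗_B Y, Y, inr)`; the upper part `s` of a section satisfies `s ∘
g = inr`, which is injective. -/
theorem injective_of_projective
    (hg : Module.Projective (TriangularMatrixRing A B M) (TripleModule g)) :
    Function.Injective g := by
  obtain ⟨s, t, hst, -, ht⟩ := exists_section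
    (g' := LinearMap.inr A X (BimoduleTensor A B M Y)) hg
    (LinearMap.coprod LinearMap.id g) LinearMap.id (by
      rw [LinearMap.coprod_inr, BimoduleTensor.map_id, LinearMap.comp_id])
    (fun x => ⟨(x, 0), by simp⟩) Function.surjective_id
  rw [LinearMap.id_comp] at ht
  subst ht
  rw [BimoduleTensor.map_id, LinearMap.comp_id] at hst
  have : Function.Injective (s ∘ g) := by
    rw [← LinearMap.coe_comp, hst]
    exact LinearMap.inr_injective
  exact this.of_comp

/-- Maps from `(X, Y, g)` to `(W, 0, 0)` are maps on the cokernel. Lifting `q` through the free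
cover of `W`, viewed as such triples, therefore gives a section on `W`. -/
theorem projective_of_exact (hg : Module.Projective (TriangularMatrixRing A B M) (TripleModule g))
    {W : Type u} [AddCommGroup W] [Module A W] (q : X →ₗ[A] W) (hgq : Function.Exact g q)
    (hq : Function.Surjective q) : Module.Projective A W := by
  have hp : Function.Surjective (Finsupp.linearCombination A (id : W → W)) :=
    Finsupp.linearCombination_id_surjective A W
  let z₁ : BimoduleTensor A B M PUnit.{u + 1} →ₗ[A] (W →₀ A) := 0
  let z₂ : BimoduleTensor A B M PUnit.{u + 1} →ₗ[A] W := 0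
  let φ : TripleModule g →ₗ[TriangularMatrixRing A B M] TripleModule z₂ := hom q 0 (by
    ext x
    simp [z₂, hgq.apply_apply_eq_zero])
  let ψ : TripleModule z₁ →ₗ[TriangularMatrixRing A B M] TripleModule z₂ :=
    hom (Finsupp.linearCombination A (id : W → W)) 0 (by simp [z₁, z₂])
  obtain ⟨σ, hσ⟩ := Module.projective_lifting_property ψ φ
    (hom_surjective hp fun y => ⟨y, rfl⟩)
  obtain ⟨s, t, hst, rfl⟩ := exists_eq_hom σ
  have hs : ∀ x, Finsupp.linearCombination A (id : W → W) (s x) = q x := fun x =>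
    congrArg Prod.fst (LinearMap.congr_fun hσ (mk g x 0))
  obtain ⟨k, hk⟩ := LinearMap.exists_comp_eq_of_surjective q hq s (by
    intro x hx
    obtain ⟨y, rfl⟩ := (hgq x).1 hx
    exact LinearMap.congr_fun hst y)
  refine Module.projective_def'.2 ⟨k, ?_⟩
  ext w
  obtain ⟨x, rfl⟩ := hq w
  have := LinearMap.congr_fun hk x
  rw [LinearMap.comp_apply] at this
  rw [LinearMap.comp_apply, this, hs, LinearMap.id_apply]

instance projective_inr (P Q : Type u) [AddCommGroup P] [Module A P] [AddCommGroup Q] [Module B Q]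
    [Module.Projective A P] [Module.Projective B Q] :
    Module.Projective (TriangularMatrixRing A B M)
      (TripleModule (LinearMap.inr A P (BimoduleTensor A B M Q))) := by
  refine Module.Projective.of_lifting_property'' fun f hf => ?_
  -- The free cover is rewritten as a triple, so that the surjection splits into surjective
  -- components.
  let e := equivTriple A B M
    (TripleModule (LinearMap.inr A P (BimoduleTensor A B M Q)) →₀ TriangularMatrixRing A B M)
  obtain ⟨a, b, h, hab⟩ := exists_eq_hom (f ∘ₗ e.symm.toLinearMap)
  have hs : Function.Surjective (hom a b h) := by
    rw [← hab]
    exact hf.comp e.symm.surjective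
  have ha : Function.Surjective a := fun x => by
    obtain ⟨v, hv⟩ := hs (mk _ x 0)
    exact ⟨v.1, congrArg Prod.fst hv⟩
  have hb : Function.Surjective b := fun x => by
    obtain ⟨v, hv⟩ := hs (mk _ 0 x)
    exact ⟨v.2, congrArg Prod.snd hv⟩
  obtain ⟨t, ht⟩ := Module.projective_lifting_property b LinearMap.id hb
  obtain ⟨s, hs⟩ := Module.projective_lifting_property a (LinearMap.inl A P _) ha
  -- The lifts on `P` and `Q` are chosen independently; compatibility dictates the value on `M ⊗_B
  -- Q`.
  let σ : TripleModule (LinearMap.inr A P (BimoduleTensor A B M Q)) →ₗ[TriangularMatrixRing A B M]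
      TripleModule (structureMap A B M _) :=
    hom (s.coprod (structureMap A B M _ ∘ₗ BimoduleTensor.map A B M t)) t
      (by rw [LinearMap.coprod_inr])
  refine ⟨e.symm.toLinearMap ∘ₗ σ, ?_⟩
  rw [← LinearMap.comp_assoc, hab]
  ext v
  obtain ⟨⟨p, z⟩, y, rfl⟩ := exists_mk v
  rw [LinearMap.comp_apply, hom_mk, hom_mk, LinearMap.id_apply, mk_inj]
  refine ⟨?_, LinearMap.congr_fun ht y⟩
  have h₁ : a (s p) = (p, 0) := LinearMap.congr_fun hs p
  have h₂ := LinearMap.congr_fun h (BimoduleTensor.map A B M t z)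
  rw [LinearMap.comp_apply, LinearMap.comp_apply, BimoduleTensor.map_map, ht,
    BimoduleTensor.map_id] at h₂
  rw [LinearMap.coprod_apply, map_add, h₁, LinearMap.comp_apply, h₂]
  simp

end Projective

end TripleModule

/-! ### Gorenstein projective triples -/

/-- The part of the snake lemma with `ker h = 0`. The upper row need only be right exact, which is
what tensoring provides. -/
theorem exists_isShortExact_coker {R : Type u} [Ring R] {U V W X Y Z F G H : Type*}
    [AddCommGroup U] [Module R U] [AddCommGroup V] [Module R V] [AddCommGroup W] [Module R W]
    [AddCommGroup X] [Module R X] [AddCommGroup Y] [Module R Y] [AddCommGroup Z] [Module R Z]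
    [AddCommGroup F] [Module R F] [AddCommGroup G] [Module R G] [AddCommGroup H] [Module R H]
    {u : U →ₗ[R] V} {v : V →ₗ[R] W} {i : X →ₗ[R] Y} {p : Y →ₗ[R] Z}
    {f : U →ₗ[R] X} {g : V →ₗ[R] Y} {h : W →ₗ[R] Z}
    {f' : X →ₗ[R] F} {g' : Y →ₗ[R] G} {h' : Z →ₗ[R] H}
    (huv : Function.Exact u v) (hv : Function.Surjective v) (hip : IsShortExact i p)
    (hh : Function.Injective h) (c₁ : i ∘ₗ f = g ∘ₗ u) (c₂ : p ∘ₗ g = h ∘ₗ v)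
    (hf : Function.Exact f f') (hf' : Function.Surjective f')
    (hg : Function.Exact g g') (hg' : Function.Surjective g')
    (he : Function.Exact h h') (hh' : Function.Surjective h') :
    ∃ (j : F →ₗ[R] G) (r : G →ₗ[R] H), IsShortExact j r ∧ j ∘ₗ f' = g' ∘ₗ i ∧
      r ∘ₗ g' = h' ∘ₗ p := by
  have d₁ : ∀ x, i (f x) = g (u x) := fun x => LinearMap.congr_fun c₁ x
  have d₂ : ∀ x, p (g x) = h (v x) := fun x => LinearMap.congr_fun c₂ x
  obtain ⟨j, hj⟩ := LinearMap.exists_comp_eq_of_surjective f' hf' (g' ∘ₗ i) (by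
    intro x hx
    obtain ⟨y, rfl⟩ := (hf x).1 hx
    rw [LinearMap.comp_apply, d₁, hg.apply_apply_eq_zero])
  obtain ⟨r, hr⟩ := LinearMap.exists_comp_eq_of_surjective g' hg' (h' ∘ₗ p) (by
    intro x hx
    obtain ⟨y, rfl⟩ := (hg x).1 hx
    rw [LinearMap.comp_apply, d₂, he.apply_apply_eq_zero])
  have ej : ∀ x, j (f' x) = g' (i x) := fun x => LinearMap.congr_fun hj x
  have er : ∀ x, r (g' x) = h' (p x) := fun x => LinearMap.congr_fun hr x
  refine ⟨j, r, ⟨?_, ?_, ?_⟩, hj, hr⟩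
  · rw [injective_iff_map_eq_zero]
    intro x hx
    obtain ⟨x, rfl⟩ := hf' x
    rw [ej] at hx
    obtain ⟨y, hy⟩ := (hg _).1 hx
    have : h (v y) = 0 := by rw [← d₂, hy, hip.exact.apply_apply_eq_zero]
    obtain ⟨z, rfl⟩ := (huv y).1 (hh (this.trans (map_zero h).symm))
    rw [← d₁] at hy
    rw [← hip.injective hy, hf.apply_apply_eq_zero]
  · intro x
    constructor
    · intro hx
      obtain ⟨x, rfl⟩ := hg' x
      rw [er] at hx
      obtain ⟨w, hw⟩ := (he _).1 hx
      obtain ⟨w, rfl⟩ := hv w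
      obtain ⟨y, hy⟩ := (hip.exact (x - g w)).1 (by rw [map_sub, d₂, hw, sub_self])
      exact ⟨f' y, by rw [ej, hy, map_sub, hg.apply_apply_eq_zero, sub_zero]⟩
    · rintro ⟨x, rfl⟩
      obtain ⟨x, rfl⟩ := hf' x
      rw [ej, er, hip.exact.apply_apply_eq_zero, map_zero]
  · intro x
    obtain ⟨x, rfl⟩ := hh' x
    obtain ⟨x, rfl⟩ := hip.surjective x
    exact ⟨g' x, er x⟩

namespace TripleModule

variable {A B M : Type u} [Ring A] [Ring B] [AddCommGroup M] [Module A M] [Module Bᵐᵒᵖ M]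
  [SMulCommClass A Bᵐᵒᵖ M]

open BimoduleTensor

/-- A short exact sequence over the matrix ring is read off as compatible short exact sequences of
the two components. -/
theorem exists_triple_cosyzygy {X Y : Type u} [AddCommGroup X] [Module A X] [AddCommGroup Y]
    [Module B Y] {g : BimoduleTensor A B M Y →ₗ[A] X}
    (hg : GorensteinProjective (TriangularMatrixRing A B M) (TripleModule g)) :
    ∃ (X₁ X₂ : ModuleCat.{u} A) (Y₁ Y₂ : ModuleCat.{u} B)
      (g₁ : BimoduleTensor A B M Y₁ →ₗ[A] X₁) (g₂ : BimoduleTensor A B M Y₂ →ₗ[A] X₂)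
      (i : X →ₗ[A] X₁) (j : Y →ₗ[B] Y₁) (p : X₁ →ₗ[A] X₂) (r : Y₁ →ₗ[B] Y₂),
      i ∘ₗ g = g₁ ∘ₗ map A B M j ∧ p ∘ₗ g₁ = g₂ ∘ₗ map A B M r ∧
      Module.Projective (TriangularMatrixRing A B M) (TripleModule g₁) ∧
      GorensteinProjective (TriangularMatrixRing A B M) (TripleModule g₂) ∧
      IsShortExact i p ∧ IsShortExact j r := by
  obtain ⟨P, G, α, β, hP, hG, hαβ⟩ := GorensteinProjective.hasProjectiveCosyzygies
    (ModuleCat.of _ (TripleModule g)) hg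
  let eP := equivTriple A B M P
  let eG := equivTriple A B M G
  obtain ⟨i, j, h, hij⟩ := exists_eq_hom (eP.toLinearMap ∘ₗ α)
  obtain ⟨p, r, h', hpr⟩ := exists_eq_hom (eG.toLinearMap ∘ₗ β ∘ₗ eP.symm.toLinearMap)
  have hS : IsShortExact (hom i j h) (hom p r h') := by
    rw [← hij, ← hpr]
    refine ⟨eP.injective.comp hαβ.injective, fun x => ?_,
      eG.surjective.comp (hαβ.surjective.comp eP.symm.surjective)⟩
    obtain ⟨x, rfl⟩ := eP.surjective x
    simpa using hαβ.exact x
  obtain ⟨hip, hjr⟩ := isShortExact_hom_iff.1 hS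
  exact ⟨ModuleCat.of A (upper A B M P), ModuleCat.of A (upper A B M G),
    ModuleCat.of B (lower A B M P), ModuleCat.of B (lower A B M G), _, _, i, j, p, r, h, h',
    Module.Projective.of_equiv eP, hG.of_equiv eG, hip, hjr⟩

theorem exists_triple_syzygy {X Y : Type u} [AddCommGroup X] [Module A X] [AddCommGroup Y]
    [Module B Y] {g : BimoduleTensor A B M Y →ₗ[A] X}
    (hg : GorensteinProjective (TriangularMatrixRing A B M) (TripleModule g)) :
    ∃ (X₁ X₂ : ModuleCat.{u} A) (Y₁ Y₂ : ModuleCat.{u} B)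
      (g₁ : BimoduleTensor A B M Y₁ →ₗ[A] X₁) (g₂ : BimoduleTensor A B M Y₂ →ₗ[A] X₂)
      (i : X₂ →ₗ[A] X₁) (j : Y₂ →ₗ[B] Y₁) (p : X₁ →ₗ[A] X) (r : Y₁ →ₗ[B] Y),
      i ∘ₗ g₂ = g₁ ∘ₗ map A B M j ∧ p ∘ₗ g₁ = g ∘ₗ map A B M r ∧
      Module.Projective (TriangularMatrixRing A B M) (TripleModule g₁) ∧
      GorensteinProjective (TriangularMatrixRing A B M) (TripleModule g₂) ∧
      IsShortExact i p ∧ IsShortExact j r := by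
  obtain ⟨P, G, α, β, hP, hG, hαβ⟩ := GorensteinProjective.hasProjectiveSyzygies
    (ModuleCat.of _ (TripleModule g)) hg
  let eP := equivTriple A B M P
  let eG := equivTriple A B M G
  obtain ⟨i, j, h, hij⟩ := exists_eq_hom (eP.toLinearMap ∘ₗ α ∘ₗ eG.symm.toLinearMap)
  obtain ⟨p, r, h', hpr⟩ := exists_eq_hom (β ∘ₗ eP.symm.toLinearMap)
  have hS : IsShortExact (hom i j h) (hom p r h') := by
    rw [← hij, ← hpr]
    refine ⟨eP.injective.comp (hαβ.injective.comp eG.symm.injective), fun x => ?_,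
      hαβ.surjective.comp eP.symm.surjective⟩
    obtain ⟨x, rfl⟩ := eP.surjective x
    have := hαβ.exact x
    rw [LinearMap.comp_apply, LinearEquiv.coe_coe, eP.symm_apply_apply, this]
    constructor
    · rintro ⟨y, rfl⟩
      exact ⟨eG y, by simp⟩
    · rintro ⟨y, hy⟩
      exact ⟨eG.symm y, eP.injective hy⟩
  obtain ⟨hip, hjr⟩ := isShortExact_hom_iff.1 hS
  exact ⟨ModuleCat.of A (upper A B M P), ModuleCat.of A (upper A B M G),
    ModuleCat.of B (lower A B M P), ModuleCat.of B (lower A B M G), _, _, i, j, p, r, h, h',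
    Module.Projective.of_equiv eP, hG.of_equiv eG, hip, hjr⟩

/-! ### Components of a Gorenstein projective triple -/

section Components

variable (A B M) in
/-- The class of lower components of Gorenstein projective triples. -/
def LowerClass (Y : ModuleCat.{u} B) : Prop :=
  ∃ (X : ModuleCat.{u} A) (g : BimoduleTensor A B M Y →ₗ[A] X),
    GorensteinProjective (TriangularMatrixRing A B M) (TripleModule g)

variable (A B M) in
/-- The class of cokernels of the structure maps of Gorenstein projective triples. -/
def CokerClass (G : ModuleCat.{u} A) : Prop :=
  ∃ (X : ModuleCat.{u} A) (Y : ModuleCat.{u} B) (g : BimoduleTensor A B M Y →ₗ[A] X)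
    (q : X →ₗ[A] G), GorensteinProjective (TriangularMatrixRing A B M) (TripleModule g) ∧
      Function.Exact g q ∧ Function.Surjective q

theorem lowerClass_cosyzygies : HasProjectiveCosyzygies (LowerClass A B M) := by
  rintro Y ⟨X, g, hg⟩
  obtain ⟨X₁, X₂, Y₁, Y₂, g₁, g₂, i, j, p, r, h, h', hP, hG, hip, hjr⟩ := exists_triple_cosyzygy hg
  exact ⟨Y₁, Y₂, j, r, projective_snd hP, ⟨X₂, g₂, hG⟩, hjr⟩

theorem lowerClass_syzygies : HasProjectiveSyzygies (LowerClass A B M) := by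
  rintro Y ⟨X, g, hg⟩
  obtain ⟨X₁, X₂, Y₁, Y₂, g₁, g₂, i, j, p, r, h, h', hP, hG, hip, hjr⟩ := exists_triple_syzygy hg
  exact ⟨Y₁, Y₂, j, r, projective_snd hP, ⟨X₂, g₂, hG⟩, hjr⟩

variable {X Y : Type u} [AddCommGroup X] [Module A X] [AddCommGroup Y] [Module B Y]
  {g : BimoduleTensor A B M Y →ₗ[A] X}

theorem torVanishes_lower (hB : TensorPreservesExact A B M)
    (hg : GorensteinProjective (TriangularMatrixRing A B M) (TripleModule g)) :
    TorVanishes A B M Y :=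
  torVanishes_of_class hB _ lowerClass_cosyzygies lowerClass_syzygies (ModuleCat.of B Y)
    ⟨ModuleCat.of A X, g, hg⟩

/-- In an embedding into a projective triple, `i ∘ g = g₁ ∘ (M ⊗ j)`; here `g₁` is injective, and so
is `M ⊗ j` because `Tor₁(M, Y₂) = 0`. -/
theorem injective_of_gorensteinProjective (hB : TensorPreservesExact A B M)
    (hg : GorensteinProjective (TriangularMatrixRing A B M) (TripleModule g)) :
    Function.Injective g := by
  obtain ⟨X₁, X₂, Y₁, Y₂, g₁, g₂, i, j, p, r, h, h', hP, hG, hip, hjr⟩ := exists_triple_cosyzygy hg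
  have : Function.Injective (i ∘ₗ g) := by
    rw [h]
    exact (injective_of_projective hP).comp (torVanishes_lower hB hG _ _ _ _ hjr)
  exact Function.Injective.of_comp (f := i) this

theorem exact_mkQ_range {X' Y' : Type*} [AddCommGroup X'] [Module A X'] [AddCommGroup Y']
    [Module A Y'] (f : X' →ₗ[A] Y') : Function.Exact f (LinearMap.range f).mkQ :=
  fun x => by simp

theorem cokerClass_cosyzygies (hB : TensorPreservesExact A B M) :
    HasProjectiveCosyzygies (CokerClass A B M) := by
  rintro G ⟨X, Y, g, q, hg, hgq, hq⟩
  obtain ⟨X₁, X₂, Y₁, Y₂, g₁, g₂, i, j, p, r, h, h', hP, hG, hip, hjr⟩ := exists_triple_cosyzygy hg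
  obtain ⟨u, v, huv, -, -⟩ := exists_isShortExact_coker
    (map_exact _ _ hjr.exact hjr.surjective) (map_surjective _ hjr.surjective) hip
    (injective_of_gorensteinProjective hB hG) h h' hgq hq
    (exact_mkQ_range g₁) (Submodule.mkQ_surjective _)
    (exact_mkQ_range g₂) (Submodule.mkQ_surjective _)
  exact ⟨ModuleCat.of A (X₁ ⧸ LinearMap.range g₁), ModuleCat.of A (X₂ ⧸ LinearMap.range g₂),
    u, v, projective_of_exact hP _ (exact_mkQ_range g₁) (Submodule.mkQ_surjective _),
    ⟨X₂, Y₂, g₂, (LinearMap.range g₂).mkQ, hG, exact_mkQ_range g₂, Submodule.mkQ_surjective _⟩,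
    huv⟩

theorem cokerClass_syzygies (hB : TensorPreservesExact A B M) :
    HasProjectiveSyzygies (CokerClass A B M) := by
  rintro G ⟨X, Y, g, q, hg, hgq, hq⟩
  obtain ⟨X₁, X₂, Y₁, Y₂, g₁, g₂, i, j, p, r, h, h', hP, hG, hip, hjr⟩ := exists_triple_syzygy hg
  obtain ⟨u, v, huv, -, -⟩ := exists_isShortExact_coker
    (map_exact _ _ hjr.exact hjr.surjective) (map_surjective _ hjr.surjective) hip
    (injective_of_gorensteinProjective hB hg) h h'
    (exact_mkQ_range g₂) (Submodule.mkQ_surjective _)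
    (exact_mkQ_range g₁) (Submodule.mkQ_surjective _) hgq hq
  exact ⟨ModuleCat.of A (X₁ ⧸ LinearMap.range g₁), ModuleCat.of A (X₂ ⧸ LinearMap.range g₂),
    u, v, projective_of_exact hP _ (exact_mkQ_range g₁) (Submodule.mkQ_surjective _),
    ⟨X₂, Y₂, g₂, (LinearMap.range g₂).mkQ, hG, exact_mkQ_range g₂, Submodule.mkQ_surjective _⟩,
    huv⟩

theorem extVanishes_cokerClass (hB : TensorPreservesExact A B M) (G : ModuleCat.{u} A)
    (hG : CokerClass A B M G) (N : Type u) [AddCommGroup N] [Module A N]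
    (hN : Module.Projective A N) : ExtVanishes A G N := by
  obtain ⟨X, Y, g, q, hg, hgq, hq⟩ := hG
  obtain ⟨X₁, X₂, Y₁, Y₂, g₁, g₂, i, j, p, r, h, h', hP, hG, hip, hjr⟩ := exists_triple_syzygy hg
  obtain ⟨u, v, huv, hu, -⟩ := exists_isShortExact_coker
    (map_exact _ _ hjr.exact hjr.surjective) (map_surjective _ hjr.surjective) hip
    (injective_of_gorensteinProjective hB hg) h h'
    (exact_mkQ_range g₂) (Submodule.mkQ_surjective _)
    (exact_mkQ_range g₁) (Submodule.mkQ_surjective _) hgq hq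
  have := projective_of_exact hP _ (exact_mkQ_range g₁) (Submodule.mkQ_surjective _)
  refine ExtVanishes.of_projective u v huv fun f => ?_
  -- The target is essentially `(N, 0, 0)`; it is written with `inr` so that its projectivity is
  -- already known.
  let φ : TripleModule g₂ →ₗ[TriangularMatrixRing A B M]
      TripleModule (LinearMap.inr A N (BimoduleTensor A B M PUnit.{u + 1})) :=
    hom (LinearMap.inl A N _ ∘ₗ f ∘ₗ (LinearMap.range g₂).mkQ) 0 (by
      rw [LinearMap.comp_assoc, LinearMap.comp_assoc, LinearMap.range_mkQ_comp]
      simp)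
  obtain ⟨Φ, hΦ⟩ := hg.extVanishes_of_projective (projective_inr N PUnit.{u + 1}) _ _
    (hom i j h) (hom p r h') (isShortExact_hom_iff.2 ⟨hip, hjr⟩) φ
  obtain ⟨a, b, hab, rfl⟩ := exists_eq_hom Φ
  have ha : ∀ x, a (i x) = (f ((LinearMap.range g₂).mkQ x), 0) := fun x =>
    congrArg Prod.fst (LinearMap.congr_fun hΦ (mk g₂ x 0))
  -- The `N`-coordinate of `a` vanishes on the image of `g₁`, because the target structure map has
  -- zero `N`-coordinate.
  obtain ⟨k, hk⟩ := LinearMap.exists_comp_eq_of_surjective (LinearMap.range g₁).mkQ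
    (Submodule.mkQ_surjective _) (LinearMap.fst A N _ ∘ₗ a) (by
      intro x hx
      obtain ⟨y, rfl⟩ := (exact_mkQ_range g₁ x).1 hx
      exact congrArg Prod.fst (LinearMap.congr_fun hab y))
  refine ⟨k, LinearMap.ext fun x => ?_⟩
  obtain ⟨x, rfl⟩ := Submodule.mkQ_surjective _ x
  have h₁ := LinearMap.congr_fun hu x
  have h₂ := LinearMap.congr_fun hk (i x)
  simp only [LinearMap.comp_apply] at h₁ h₂ ⊢
  rw [h₁, h₂, ha]
  rfl

theorem gorensteinProjective_of_cokerClass (hB : TensorPreservesExact A B M) (G : ModuleCat.{u} A)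
    (hG : CokerClass A B M G) : GorensteinProjective A G :=
  GorensteinProjective.of_class _ (cokerClass_cosyzygies hB) (cokerClass_syzygies hB)
    (extVanishes_cokerClass hB) G hG

theorem gorensteinProjective_coker (hB : TensorPreservesExact A B M)
    (hg : GorensteinProjective (TriangularMatrixRing A B M) (TripleModule g)) :
    GorensteinProjective A (X ⧸ LinearMap.range g) :=
  gorensteinProjective_of_cokerClass hB (ModuleCat.of A (X ⧸ LinearMap.range g))
    ⟨ModuleCat.of A X, ModuleCat.of B Y, g, (LinearMap.range g).mkQ, hg, exact_mkQ_range g,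
      Submodule.mkQ_surjective _⟩

theorem extVanishes_lowerClass (hB : TensorPreservesExact A B M) (hA : AddHomExact A M)
    (Y : ModuleCat.{u} B) (hY : LowerClass A B M Y) (Q : Type u) [AddCommGroup Q] [Module B Q]
    (hQ : Module.Projective B Q) : ExtVanishes B Y Q := by
  obtain ⟨X, g, hg⟩ := hY
  obtain ⟨X₁, X₂, Y₁, Y₂, g₁, g₂, i, j, p, r, h, h', hP, hG, hip, hjr⟩ := exists_triple_syzygy hg
  have := projective_snd hP
  refine ExtVanishes.of_projective j r hjr fun f => ?_
  -- To turn `f` into a map of triples with target `(M ⊗_B Q, Q, id)`, `M ⊗ f` must extend along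
  -- `g₂`; this is where (ii) enters.
  obtain ⟨e, he⟩ := (gorensteinProjective_coker hB hG).extVanishes_tensor hA Q _ _ g₂
    (LinearMap.range g₂).mkQ (isShortExact_mkQ g₂ (injective_of_gorensteinProjective hB hG))
    (map A B M f)
  let φ : TripleModule g₂ →ₗ[TriangularMatrixRing A B M]
      TripleModule (LinearMap.inr A PUnit.{u + 1} (BimoduleTensor A B M Q)) :=
    hom (LinearMap.inr A PUnit.{u + 1} _ ∘ₗ e) f (by rw [LinearMap.comp_assoc, he])
  obtain ⟨Φ, hΦ⟩ := hg.extVanishes_of_projective (projective_inr PUnit.{u + 1} Q) _ _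
    (hom i j h) (hom p r h') (isShortExact_hom_iff.2 ⟨hip, hjr⟩) φ
  obtain ⟨a, b, hab, rfl⟩ := exists_eq_hom Φ
  refine ⟨b, LinearMap.ext fun y => ?_⟩
  exact congrArg Prod.snd (LinearMap.congr_fun hΦ (mk g₂ 0 y))

theorem gorensteinProjective_lower (hB : TensorPreservesExact A B M) (hA : AddHomExact A M)
    (hg : GorensteinProjective (TriangularMatrixRing A B M) (TripleModule g)) :
    GorensteinProjective B Y :=
  GorensteinProjective.of_class _ lowerClass_cosyzygies lowerClass_syzygies
    (extVanishes_lowerClass hB hA) (ModuleCat.of B Y) ⟨ModuleCat.of A X, g, hg⟩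

end Components

end TripleModule

namespace TripleModule

variable {A B M : Type u} [Ring A] [Ring B] [AddCommGroup M] [Module A M] [Module Bᵐᵒᵖ M]
  [SMulCommClass A Bᵐᵒᵖ M]

open BimoduleTensor

/-! ### Triples with injective structure map -/

section Monic

/-- The class of modules given by triples with an injective structure map whose cokernel and
lower component are Gorenstein projective. -/
def MonicClass (V : ModuleCat.{u} (TriangularMatrixRing A B M)) : Prop :=
  ∃ (X G : ModuleCat.{u} A) (Y : ModuleCat.{u} B) (g : BimoduleTensor A B M Y →ₗ[A] X)
    (q : X →ₗ[A] G), Nonempty (V ≃ₗ[TriangularMatrixRing A B M] TripleModule g) ∧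
      IsShortExact g q ∧ GorensteinProjective A G ∧ GorensteinProjective B Y

theorem monicClass_cosyzygies (hB : TensorPreservesExact A B M) (hA : AddHomExact A M) :
    HasProjectiveCosyzygies (MonicClass (A := A) (B := B) (M := M)) := by
  rintro V ⟨X, G, Y, g, q, ⟨e⟩, hgq, hG, hY⟩
  obtain ⟨P, G', ι, π, hP, hG', hιπ⟩ := GorensteinProjective.hasProjectiveCosyzygies G hG
  obtain ⟨Q, Y', j, r, hQ, hY', hjr⟩ := GorensteinProjective.hasProjectiveCosyzygies Y hY
  -- Dual horseshoe: `Ext¹(G, M ⊗_B Q) = 0` extends `M ⊗ j` to `X`, and `(ι ∘ q, s)` then embeds `X`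
  -- in `P ⊕ M ⊗_B Q`.
  obtain ⟨s, hs⟩ := hG.extVanishes_tensor hA Q _ _ g q hgq (map A B M j)
  have hs' : ∀ t, s (g t) = map A B M j t := fun t => LinearMap.congr_fun hs t
  have hj : Function.Injective (map A B M j) := hY'.torVanishes hB _ _ _ _ hjr
  have hr := map_surjective (A := A) (M := M) r hjr.surjective
  have hjr' := map_exact (A := A) (M := M) j r hjr.exact hjr.surjective
  let i : X →ₗ[A] P × BimoduleTensor A B M Q := (ι ∘ₗ q).prod s
  have hi_apply : ∀ x, i x = (ι (q x), s x) := fun _ => rfl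
  have hi : Function.Injective i := by
    rw [injective_iff_map_eq_zero]
    intro x hx
    rw [hi_apply, Prod.mk_eq_zero] at hx
    obtain ⟨t, rfl⟩ := (hgq.exact x).1 (hιπ.injective (hx.1.trans (map_zero ι).symm))
    rw [hs'] at hx
    rw [hj (hx.2.trans (map_zero _).symm), map_zero]
  have hig : i ∘ₗ g = LinearMap.inr A P _ ∘ₗ map A B M j := by
    refine LinearMap.ext fun t => Prod.ext ?_ ?_
    · change ι (q (g t)) = 0
      rw [hgq.exact.apply_apply_eq_zero, map_zero]
    · exact hs' t
  have hp := isShortExact_mkQ i hi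
  obtain ⟨g', hg'⟩ := LinearMap.exists_comp_eq_of_surjective (map A B M r) hr
    ((LinearMap.range i).mkQ ∘ₗ LinearMap.inr A P _) (by
      intro t ht
      obtain ⟨t, rfl⟩ := (hjr' t).1 ht
      have := LinearMap.congr_fun hig t
      rw [LinearMap.comp_apply, LinearMap.comp_apply] at this
      rw [LinearMap.comp_apply, ← this, hp.exact.apply_apply_eq_zero])
  have hg'_apply : ∀ t, g' (map A B M r t) = (LinearMap.range i).mkQ (0, t) :=
    fun t => LinearMap.congr_fun hg' t
  obtain ⟨q', hq'⟩ := LinearMap.exists_comp_eq_of_surjective (LinearMap.range i).mkQ hp.surjective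
    (π ∘ₗ LinearMap.fst A P (BimoduleTensor A B M Q)) (by
      intro x hx
      obtain ⟨x, rfl⟩ := (hp.exact x).1 hx
      exact hιπ.exact.apply_apply_eq_zero _)
  have hq'_apply : ∀ x, q' ((LinearMap.range i).mkQ x) = π x.1 := fun x => LinearMap.congr_fun hq' x
  have hS : IsShortExact (hom i j hig) (hom (LinearMap.range i).mkQ r hg'.symm) :=
    isShortExact_hom_iff.2 ⟨hp, hjr⟩
  refine ⟨ModuleCat.of _ (TripleModule (LinearMap.inr A P (BimoduleTensor A B M Q))),
    ModuleCat.of _ (TripleModule g'), hom i j hig ∘ₗ e.toLinearMap,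
    hom (LinearMap.range i).mkQ r hg'.symm, projective_inr P Q,
    ⟨ModuleCat.of A (_ ⧸ LinearMap.range i), G', Y', g', q', ⟨LinearEquiv.refl _ _⟩,
      ⟨?_, ?_, ?_⟩, hG', hY'⟩, hS.injective.comp e.injective, fun x => ?_, hS.surjective⟩
  · rw [injective_iff_map_eq_zero]
    intro t ht
    obtain ⟨t, rfl⟩ := hr t
    rw [hg'_apply] at ht
    obtain ⟨x, hx⟩ := (hp.exact _).1 ht
    rw [hi_apply, Prod.mk_inj] at hx
    obtain ⟨z, rfl⟩ := (hgq.exact x).1 (hιπ.injective (hx.1.trans (map_zero ι).symm))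
    rw [← hx.2, hs', hjr'.apply_apply_eq_zero]
  · intro x
    obtain ⟨⟨x, t⟩, rfl⟩ := hp.surjective x
    rw [hq'_apply, hιπ.exact]
    constructor
    · rintro ⟨y, hy⟩
      obtain ⟨y, rfl⟩ := hgq.surjective y
      -- With `x = ι (q y)`, the pairs `(x, t)` and `(0, t - s y)` differ by `i y`.
      refine ⟨map A B M r (t - s y), ?_⟩
      rw [hg'_apply, ← sub_eq_zero, ← map_sub]
      refine (hp.exact _).2 ⟨-y, ?_⟩
      rw [map_neg, hi_apply, hy]
      simp
    · rintro ⟨z, hz⟩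
      obtain ⟨z, rfl⟩ := hr z
      rw [hg'_apply, ← sub_eq_zero, ← map_sub] at hz
      obtain ⟨y, hy⟩ := (hp.exact _).1 hz
      refine ⟨q (-y), ?_⟩
      have := congrArg Prod.fst hy
      rw [map_neg, map_neg, show ι (q y) = 0 - x from this, zero_sub, neg_neg]
  · intro x
    obtain ⟨x, rfl⟩ := hιπ.surjective x
    exact ⟨(LinearMap.range i).mkQ (x, 0), hq'_apply _⟩
  · rw [hS.exact x]
    exact e.surjective.exists (p := fun y => hom i j hig y = x)

/-- The explicit projective presentation of a triple with injective structure map. -/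
theorem exists_monic_syzygy (hB : TensorPreservesExact A B M) {X G : ModuleCat.{u} A}
    {Y : ModuleCat.{u} B} {g : BimoduleTensor A B M Y →ₗ[A] X} {q : X →ₗ[A] G}
    (hgq : IsShortExact g q) (hG : GorensteinProjective A G) (hY : GorensteinProjective B Y) :
    ∃ (P G' X' : ModuleCat.{u} A) (Q Y' : ModuleCat.{u} B)
      (g' : BimoduleTensor A B M Y' →ₗ[A] X') (q' : X' →ₗ[A] G')
      (ι : G' →ₗ[A] P) (π : P →ₗ[A] G) (i : X' →ₗ[A] P × BimoduleTensor A B M Q)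
      (p : P × BimoduleTensor A B M Q →ₗ[A] X) (j : Y' →ₗ[B] Q) (r : Q →ₗ[B] Y)
      (_ : i ∘ₗ g' = LinearMap.inr A P (BimoduleTensor A B M Q) ∘ₗ map A B M j)
      (_ : p ∘ₗ LinearMap.inr A P (BimoduleTensor A B M Q) = g ∘ₗ map A B M r),
      Module.Projective A P ∧ Module.Projective B Q ∧
      GorensteinProjective A G' ∧ GorensteinProjective B Y' ∧ IsShortExact g' q' ∧
      IsShortExact ι π ∧ IsShortExact i p ∧ IsShortExact j r ∧
      ι ∘ₗ q' = LinearMap.fst A P _ ∘ₗ i := by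
  obtain ⟨P, G', ι, π, hP, hG', hιπ⟩ := GorensteinProjective.hasProjectiveSyzygies G hG
  obtain ⟨Q, Y', j, r, hQ, hY', hjr⟩ := GorensteinProjective.hasProjectiveSyzygies Y hY
  -- Horseshoe: a lift of `π` to `X` combines with `g ∘ (M ⊗ r)` to cover `X`.
  obtain ⟨t, ht⟩ := Module.projective_lifting_property q π hgq.surjective
  have ht' : ∀ x, q (t x) = π x := fun x => LinearMap.congr_fun ht x
  have hj : Function.Injective (map A B M j) := hY.torVanishes hB _ _ _ _ hjr
  have hr := map_surjective (A := A) (M := M) r hjr.surjective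
  have hjr' := map_exact (A := A) (M := M) j r hjr.exact hjr.surjective
  let p : P × BimoduleTensor A B M Q →ₗ[A] X := t.coprod (g ∘ₗ map A B M r)
  have hp_apply : ∀ x z, p (x, z) = t x + g (map A B M r z) := fun x z => by simp [p]
  have hps : Function.Surjective p := by
    intro x
    obtain ⟨y, hy⟩ := hιπ.surjective (q x)
    obtain ⟨z, hz⟩ := (hgq.exact (x - t y)).1 (by rw [map_sub, ht', hy, sub_self])
    obtain ⟨z, rfl⟩ := hr z
    exact ⟨(y, z), by rw [hp_apply, hz, add_sub_cancel]⟩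
  have hip := isShortExact_ker p hps
  obtain ⟨g', hg'⟩ := LinearMap.exists_comp_eq_of_injective _ hip.injective
    (LinearMap.inr A P (BimoduleTensor A B M Q) ∘ₗ map A B M j) (fun z => (hip.exact _).1 (by
      rw [LinearMap.comp_apply, LinearMap.inr_apply, hp_apply, hjr'.apply_apply_eq_zero]
      simp))
  have hg'_apply : ∀ z, (g' z : P × BimoduleTensor A B M Q) = (0, map A B M j z) :=
    fun z => LinearMap.congr_fun hg' z
  obtain ⟨q', hq'⟩ := LinearMap.exists_comp_eq_of_injective ι hιπ.injective
    (LinearMap.fst A P _ ∘ₗ (LinearMap.ker p).subtype) (by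
      rintro ⟨⟨x, z⟩, hx⟩
      refine (hιπ.exact x).1 ?_
      have := congrArg q (LinearMap.mem_ker.1 hx)
      rwa [hp_apply, map_add, ht', hgq.exact.apply_apply_eq_zero, add_zero, map_zero] at this)
  have hq'_apply : ∀ x, ι (q' x) = x.1.1 := fun x => LinearMap.congr_fun hq' x
  refine ⟨P, G', ModuleCat.of A (LinearMap.ker p), Q, Y', g', q', ι, π, (LinearMap.ker p).subtype,
    p, j, r, hg', LinearMap.coprod_inr _ _, hP, hQ, hG', hY', ⟨?_, ?_, ?_⟩, hιπ, hip, hjr, hq'⟩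
  · intro z z' hz
    have := congrArg Subtype.val hz
    rw [hg'_apply, hg'_apply] at this
    exact hj (congrArg Prod.snd this)
  · rintro ⟨⟨x, z⟩, hx⟩
    constructor
    · intro h
      have hx0 : x = 0 := by
        rw [← map_zero ι, ← h]
        exact (hq'_apply ⟨⟨x, z⟩, hx⟩).symm
      subst hx0
      rw [LinearMap.mem_ker, hp_apply, map_zero, zero_add] at hx
      obtain ⟨y, rfl⟩ := (hjr' z).1 (hgq.injective (hx.trans (map_zero g).symm))
      exact ⟨y, Subtype.ext (hg'_apply y)⟩
    · rintro ⟨y, hy⟩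
      rw [← hy]
      refine hιπ.injective ?_
      rw [hq'_apply, hg'_apply, map_zero]
  · intro x
    -- Since `q` kills `t (ι x)`, it comes from `M ⊗_B Q`; subtracting that correction puts `(ι x,
    -- -z)` in the kernel of `p`.
    obtain ⟨z, hz⟩ := (hgq.exact (t (ι x))).1 (by rw [ht', hιπ.exact.apply_apply_eq_zero])
    obtain ⟨z, rfl⟩ := hr z
    refine ⟨⟨(ι x, -z), ?_⟩, hιπ.injective (hq'_apply _)⟩
    rw [LinearMap.mem_ker, hp_apply, map_neg, map_neg, hz, add_neg_cancel]

theorem monicClass_syzygies (hB : TensorPreservesExact A B M) :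
    HasProjectiveSyzygies (MonicClass (A := A) (B := B) (M := M)) := by
  rintro V ⟨X, G, Y, g, q, ⟨e⟩, hgq, hG, hY⟩
  obtain ⟨P, G', X', Q, Y', g', q', ι, π, i, p, j, r, hi, hp, hP, hQ, hG', hY', hgq', hιπ, hip, hjr,
    hιq⟩ := exists_monic_syzygy hB hgq hG hY
  have hS : IsShortExact (hom i j hi) (hom p r hp) := isShortExact_hom_iff.2 ⟨hip, hjr⟩
  refine ⟨ModuleCat.of _ (TripleModule (LinearMap.inr A P (BimoduleTensor A B M Q))),
    ModuleCat.of _ (TripleModule g'), hom i j hi, e.symm.toLinearMap ∘ₗ hom p r hp,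
    projective_inr P Q, ⟨X', G', Y', g', q', ⟨LinearEquiv.refl _ _⟩, hgq', hG', hY'⟩,
    hS.injective, fun x => ?_, e.symm.surjective.comp hS.surjective⟩
  rw [← hS.exact x]
  simp

theorem extVanishes_monicClass (hB : TensorPreservesExact A B M) (hA : AddHomExact A M)
    (V : ModuleCat.{u} (TriangularMatrixRing A B M)) (hV : MonicClass V) (N : Type u)
    [AddCommGroup N] [Module (TriangularMatrixRing A B M) N]
    (hN : Module.Projective (TriangularMatrixRing A B M) N) :
    ExtVanishes (TriangularMatrixRing A B M) V N := by
  obtain ⟨X, G, Y, g, q, ⟨e⟩, hgq, hG, hY⟩ := hV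
  refine ExtVanishes.of_equiv e.symm ?_
  obtain ⟨P, G', X', Q, Y', g', q', ι, π, i, p, j, r, hi, hp, hP, hQ, hG', hY', hgq', hιπ, hip, hjr,
    hιq⟩ := exists_monic_syzygy hB hgq hG hY
  refine ExtVanishes.of_projective (hom i j hi) (hom p r hp)
    (isShortExact_hom_iff.2 ⟨hip, hjr⟩) fun φ => ?_
  let eN := equivTriple A B M N
  let gN := structureMap A B M N
  have hN' : Module.Projective (TriangularMatrixRing A B M) (TripleModule gN) :=
    Module.Projective.of_equiv eN
  have hNl : Module.Projective B (lower A B M N) := projective_snd hN'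
  have hNc : Module.Projective A (upper A B M N ⧸ LinearMap.range gN) :=
    projective_of_exact hN' _ (exact_mkQ_range gN) (Submodule.mkQ_surjective _)
  -- The upper part of a projective triple is an extension of its projective cokernel by `M ⊗_B N₂`,
  -- where `N₂` is its projective lower part, so (ii) covers it.
  have hGN : ExtVanishes A G (upper A B M N) :=
    ExtVanishes.of_split gN (LinearMap.range gN).mkQ
      (isShortExact_mkQ gN (injective_of_projective hN')) (hG.extVanishes_tensor hA _)
      (hG.extVanishes_of_projective hNc)
  obtain ⟨a, b, hab, hφ⟩ := exists_eq_hom (eN.toLinearMap ∘ₗ φ)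
  obtain ⟨β, hβ⟩ := hY.extVanishes_of_projective hNl _ _ j r hjr b
  have hβ' : map A B M β ∘ₗ map A B M j = map A B M b := by rw [← map_comp, hβ]
  -- The extension `β` dictates the map on `M ⊗_B Q`. The discrepancy `a - α₀ ∘ i` vanishes on the
  -- image of `g'`, so it lives on `G'`, and `Ext¹(G, N₁) = 0`, with `N₁` the upper part of `N`,
  -- extends it to `P`.
  let α₀ : P × BimoduleTensor A B M Q →ₗ[A] upper A B M N :=
    gN ∘ₗ map A B M β ∘ₗ LinearMap.snd A P _
  obtain ⟨δ, hδ⟩ := LinearMap.exists_comp_eq_of_surjective q' hgq'.surjective (a - α₀ ∘ₗ i) (by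
    intro x hx
    obtain ⟨y, rfl⟩ := (hgq'.exact x).1 hx
    have h₁ : a (g' y) = gN (map A B M b y) := LinearMap.congr_fun hab y
    have h₂ : i (g' y) = (0, map A B M j y) := LinearMap.congr_fun hi y
    have h₃ : map A B M β (map A B M j y) = map A B M b y := LinearMap.congr_fun hβ' y
    rw [LinearMap.sub_apply, LinearMap.comp_apply, h₁, h₂]
    change _ - gN (map A B M β (map A B M j y)) = 0
    rw [h₃, sub_self])
  obtain ⟨D, hD⟩ := hGN _ _ ι π hιπ δ
  let α := α₀ + D ∘ₗ LinearMap.fst A P _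
  have hα : α ∘ₗ i = a := by
    rw [LinearMap.add_comp, LinearMap.comp_assoc _ _ D, ← hιq, ← LinearMap.comp_assoc, hD, hδ,
      add_sub_cancel]
  have hαβ : α ∘ₗ LinearMap.inr A P _ = gN ∘ₗ map A B M β := by
    rw [LinearMap.add_comp, LinearMap.comp_assoc _ _ D, LinearMap.fst_comp_inr, LinearMap.comp_zero,
      add_zero, LinearMap.comp_assoc, LinearMap.comp_assoc, LinearMap.snd_comp_inr,
      LinearMap.comp_id]
  refine ⟨eN.symm.toLinearMap ∘ₗ hom α β hαβ, ?_⟩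
  have : hom α β hαβ ∘ₗ hom i j hi = eN.toLinearMap ∘ₗ φ := by
    rw [hφ]
    ext v
    exact Prod.ext (LinearMap.congr_fun hα v.1) (LinearMap.congr_fun hβ v.2)
  rw [LinearMap.comp_assoc, this]
  ext v
  simp

end Monic

end TripleModule

theorem corollary4p4 (A B M : Type u) [Ring A] [Ring B] [AddCommGroup M] [Module A M]
    [Module Bᵐᵒᵖ M] [SMulCommClass A Bᵐᵒᵖ M]
    (hB : ∀ (C : ExactProjectiveComplex B) (i : ℤ), Function.Exact
      (BimoduleTensor.map A B M (C.d i)) (BimoduleTensor.map A B M (C.d (i + 1))))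
    (hA : ∀ C : ExactProjectiveComplex A, C.IsComplete →
      ∀ (N : Type u) [AddCommGroup N] [Module A N], MemAdd A M N → C.HomExact N)
    (X Y : Type u) [AddCommGroup X] [Module A X] [AddCommGroup Y] [Module B Y]
    (g : BimoduleTensor A B M Y →ₗ[A] X) :
    GorensteinProjective (TriangularMatrixRing A B M) (TripleModule g) ↔
      GorensteinProjective A (X ⧸ LinearMap.range g) ∧ GorensteinProjective B Y ∧
        Function.Injective g := by
  constructor
  · intro h
    exact ⟨TripleModule.gorensteinProjective_coker hB h,
      TripleModule.gorensteinProjective_lower hB hA h,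
      TripleModule.injective_of_gorensteinProjective hB h⟩
  · rintro ⟨hG, hY, hg⟩
    exact GorensteinProjective.of_class TripleModule.MonicClass
      (TripleModule.monicClass_cosyzygies hB hA) (TripleModule.monicClass_syzygies hB)
      (TripleModule.extVanishes_monicClass hB hA) (ModuleCat.of _ (TripleModule g))
      ⟨ModuleCat.of A X, ModuleCat.of A (X ⧸ LinearMap.range g), ModuleCat.of B Y, g,
        (LinearMap.range g).mkQ, ⟨LinearEquiv.refl _ _⟩, isShortExact_mkQ g hg, hG, hY⟩
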